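/- Let $B, B_0,B_1,B_2,\dots$ be i.i.d. random variables with $P(B>0)=1$ and $P(B>x)=L(x)x^{-\alpha}$ for all $x>0$, where $\alpha>2$, $\alpha\neq 3$, and $L$ is slowly varying, i.e. $\lim_{x\to\infty}L(ax)/L(x)=1$ for every $a>0$. Let $N$ be a Poisson process with rate $1/E[B]$, independent of $(B_i)_{i\ge 0}$. For $\rho\in[0,1)$ let $$X^\rho(t)=B_0+\sum_{i=1}^{N(\rho t)}B_i-t\quad(t\ge 0),\qquad \tau^\rho=\inf\{t\ge 0: X^\rho(t)=0\},\qquad B^\rho_\tau=\sup\{B_i: 0\le i\le N(\rho\,\tau^\rho)\},$$ so that $B^\rho_\tau$ is the largest jump until the first hitting time $\tau^\rho$ of zero (the initial value $B_0$ counts as a jump). Let $\hat x_\rho$ be real numbers with $P(B>\hat x_\rho)/(1-\rho)^2\to 0$ as $\rho\uparrow 1$. Then $$\sup_{x\ge \hat x_\rho}\left|\frac{P(B^\rho_\tau>x)}{\frac{1}{1-\rho}P(B>x)}-1\right|\to 0\qquad\text{as }\rho\uparrow 1.$$ In particular, the same conclusion holds for every choice of $\hat x_\rho$ with $\hat x_\rho\ge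 1/(1-\rho)$ for all $\rho<1$ sufficiently close to $1$. -/

import Mathlib

open MeasureTheory ProbabilityTheory Filter Topology
open scoped NNReal ENNReal

/-- `L` is slowly varying at infinity. -/
def SlowlyVarying (L : ℝ → ℝ) : Prop :=
  ∀ a : ℝ, 0 < a → Tendsto (fun x => L (a * x) / L x) atTop (𝓝 1)

/-- `N` is a (homogeneous) Poisson process with rate `r` on the probability space `(Ω, P)`:
it starts in zero, has independent Poisson distributed increments, and almost all of its sample
paths are nondecreasing and right-continuous. The path conditions make the truncated subtraction
of `ℕ` in the increments `N t - N s`, `s ≤ t`, an ordinary subtraction almost surely. -/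
structure IsPoissonProcess {Ω : Type*} [MeasurableSpace Ω] (N : ℝ≥0 → Ω → ℕ) (r : ℝ≥0)
    (P : Measure Ω) : Prop where
  measurable : ∀ t, Measurable (N t)
  start_zero : ∀ᵐ ω ∂P, N 0 ω = 0
  monotone : ∀ᵐ ω ∂P, Monotone fun t => N t ω
  right_continuous : ∀ᵐ ω ∂P, ∀ t, ContinuousWithinAt (fun s => N s ω) (Set.Ici t) t
  increments_law : ∀ s t : ℝ≥0, s ≤ t →
    HasLaw (fun ω => N t ω - N s ω) (poissonMeasure (r * (t - s))) P
  increments_indep : HasIndepIncrements N P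

section CompoundPoisson

variable {Ω : Type*}

/-- The compound Poisson process with unit negative drift and initial value `B 0`,
`X(t) = B₀ + ∑_{1 ≤ i ≤ N(ρ t)} Bᵢ - t`, evaluated at the outcome `ω`. -/
noncomputable def compoundPoisson (B : ℕ → Ω → ℝ) (N : ℝ≥0 → Ω → ℕ) (ρ t : ℝ≥0) (ω : Ω) : ℝ :=
  B 0 ω + ∑ i ∈ Finset.Icc 1 (N (ρ * t) ω), B i ω - t

/-- The first hitting time of zero, `τ = inf {t ≥ 0 : X(t) = 0}`, which is `∞` if zero is
never hit. -/
noncomputable def hitZero (B : ℕ → Ω → ℝ) (N : ℝ≥0 → Ω → ℕ) (ρ : ℝ≥0) (ω : Ω) : ℝ≥0∞ :=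
  ⨅ (t : ℝ≥0) (_ : compoundPoisson B N ρ t ω = 0), (t : ℝ≥0∞)

/-- The largest jump until time `τ`, `B_τ = sup {Bᵢ : 0 ≤ i ≤ N(ρ τ)}`, an extended real number.
An index `i` is taken into account if `i ≤ N(ρ t)` for some finite time `t ≤ τ`; for `τ < ∞` and
nondecreasing `N` this says `i ≤ N(ρ τ)`. -/
noncomputable def largestJump (B : ℕ → Ω → ℝ) (N : ℝ≥0 → Ω → ℕ) (ρ : ℝ≥0) (ω : Ω) : EReal :=
  ⨆ (i : ℕ) (_ : ∃ t : ℝ≥0, (t : ℝ≥0∞) ≤ hitZero B N ρ ω ∧ i ≤ N (ρ * t) ω), (B i ω : EReal)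

end CompoundPoisson

/-! Let `q` be the probability that the largest jump exceeds `x`, `γ = 1 - q`, `r = 1 / E[B]`, `G =
P(B > x)`. The proof rests on the equation `1 - q = E[exp(-r ρ q B); B ≤ x]`. Heuristically, during
the time needed to work off `B₀` a Poisson number of independent copies of the excursion starts, and
none may contain a jump above `x`.

The equation is obtained from an exponential martingale. For a solution `γ` in `[0, 1]` and `θ = r ρ
(1 - γ)`, the process `exp(-θ X)`, killed at the first jump above `x`, is a martingale with initial
mean `γ`. Since `X` moves down continuously, it equals `1` at the hitting time, so optional stopping
gives the probability `γ`. This is carried out on a time grid of step `h`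
(`measure_iUnion_exitPaths`), where the overshoot costs a factor of at most `exp(θ h)`, and then `h
→ 0` (`measure_largestJump_le`). A solution exists by the intermediate value theorem.

Expanding the exponential with `r E[B] = 1` gives `q (1 - ρ) ≤ G`, with relative error of order `√G
/ (1 - ρ)` plus `G / (1 - ρ)²` (`fixedPoint_bounds`, `abs_div_sub_one_le`). Only `E[B²] < ∞` is
used, which follows from `α > 2`. Monotonicity of the tail makes the estimate uniform in `x`. -/

namespace ProbabilityTheory

/-! ### Independence of one step from the past. -/

variable {Ω : Type*} [MeasurableSpace Ω] {P : Measure Ω}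

/-- If `X₁`, `X₂` are independent and `(X₁, X₂)` is independent of `Y`, then `X₂` is independent
of `(X₁, Y)`. -/
theorem IndepFun.prodMk_of_prodMk [IsProbabilityMeasure P] {E₁ E₂ F : Type*} [MeasurableSpace E₁]
    [MeasurableSpace E₂] [MeasurableSpace F] {X₁ : Ω → E₁} {X₂ : Ω → E₂} {Y : Ω → F}
    (h₁ : Measurable X₁) (h₂ : Measurable X₂) (hY : Measurable Y) (hX : IndepFun X₁ X₂ P)
    (hXY : IndepFun (fun ω => (X₁ ω, X₂ ω)) Y P) :
    IndepFun X₂ (fun ω => (X₁ ω, Y ω)) P := by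
  have := Measure.isProbabilityMeasure_map (μ := P) h₁.aemeasurable
  have := Measure.isProbabilityMeasure_map (μ := P) h₂.aemeasurable
  have := Measure.isProbabilityMeasure_map (μ := P) hY.aemeasurable
  have hX' := (indepFun_iff_map_prod_eq_prod_map_map h₂.aemeasurable h₁.aemeasurable).1 hX.symm
  have h1Y : IndepFun X₁ Y P := hXY.comp (φ := Prod.fst) (ψ := id) measurable_fst measurable_id
  have h1Y' := (indepFun_iff_map_prod_eq_prod_map_map h₁.aemeasurable hY.aemeasurable).1 h1Y
  have h21Y : IndepFun (fun ω => (X₂ ω, X₁ ω)) Y P :=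
    hXY.comp (φ := Prod.swap) (ψ := id) measurable_swap measurable_id
  have h21Y' := (indepFun_iff_map_prod_eq_prod_map_map (h₂.prodMk h₁).aemeasurable
    hY.aemeasurable).1 h21Y
  rw [indepFun_iff_map_prod_eq_prod_map_map h₂.aemeasurable (h₁.prodMk hY).aemeasurable, h1Y']
  rw [hX'] at h21Y'
  rw [← (measurePreserving_prodAssoc (P.map X₂) (P.map X₁) (P.map Y)).map_eq, ← h21Y',
    Measure.map_map (by fun_prop) (by fun_prop)]
  rfl

/-- The `k`-th partial sum of a sequence of counts. -/
def count (d : ℕ → ℕ) (k : ℕ) : ℕ := ∑ j ∈ Finset.range k, d j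

theorem count_succ (d : ℕ → ℕ) (k : ℕ) : count d (k + 1) = count d k + d k :=
  Finset.sum_range_succ _ _

theorem count_mono (d : ℕ → ℕ) : Monotone (count d) :=
  monotone_nat_of_le_succ fun k => by rw [count_succ]; omega

theorem count_congr {d d' : ℕ → ℕ} {k : ℕ} (h : ∀ j < k, d j = d' j) : count d k = count d' k :=
  Finset.sum_congr rfl fun j hj => h j (Finset.mem_range.1 hj)

@[fun_prop]
theorem measurable_count (k : ℕ) : Measurable fun d : ℕ → ℕ => count d k := by
  unfold count; fun_prop

/-- `φ (b, d)` only depends on the counts `d j`, `j < k`, and on the jumps `b i`,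
`i ≤ ∑_{j < k} d j`. -/
def DependsOnPast {β : Type*} (k : ℕ) (φ : (ℕ → ℝ) × (ℕ → ℕ) → β) : Prop :=
  ∀ b b' d d', (∀ j < k, d j = d' j) → (∀ i ≤ count d k, b i = b' i) → φ (b, d) = φ (b', d')

/-- Extension by a default value of a finite subfamily. -/
def extendFamily {β : Type*} (s : Finset ℕ) (c : β) (v : s → β) (i : ℕ) : β :=
  if h : i ∈ s then v ⟨i, h⟩ else c

theorem measurable_extendFamily {β : Type*} [MeasurableSpace β] (s : Finset ℕ) (c : β) :
    Measurable (extendFamily s c) := by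
  refine measurable_pi_lambda _ fun i => ?_
  unfold extendFamily
  split_ifs with h
  · exact measurable_pi_apply _
  · exact measurable_const

/-- The index range of the new jumps is random, so the integral is split over the values `n` of the
past count and `m` of the new count. On each cell the ranges `0..n` and `n+1..n+m` are fixed and
disjoint, and past, new count and new jumps are independent. -/
theorem lintegral_mul_prod_Ico [IsProbabilityMeasure P] {B : ℕ → Ω → ℝ} {D : ℕ → Ω → ℕ}
    (hBm : ∀ i, Measurable (B i)) (hDm : ∀ j, Measurable (D j))
    (hB : iIndepFun B P) (hBi : ∀ i, IdentDistrib (B i) (B 0) P P) (hD : iIndepFun D P)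
    (hBD : IndepFun (fun ω i => B i ω) (fun ω j => D j ω) P)
    {g : ℝ → ℝ≥0∞} (hg : Measurable g) {k : ℕ} {φ : (ℕ → ℝ) × (ℕ → ℕ) → ℝ≥0∞}
    (hφ : Measurable φ) (hφk : DependsOnPast k φ) :
    ∫⁻ ω, φ (fun i => B i ω, fun j => D j ω) *
        ∏ i ∈ Finset.Ico (count (fun j => D j ω) k + 1) (count (fun j => D j ω) (k + 1) + 1),
          g (B i ω) ∂P =
      (∫⁻ ω, φ (fun i => B i ω, fun j => D j ω) ∂P) *
        ∑' m, P {ω | D k ω = m} * (∫⁻ ω, g (B 0 ω) ∂P) ^ m := by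
  classical
  set 𝓑 : Ω → ℕ → ℝ := fun ω i => B i ω with h𝓑
  set 𝓓 : Ω → ℕ → ℕ := fun ω j => D j ω with h𝓓
  have h𝓑m : Measurable 𝓑 := measurable_pi_lambda _ hBm
  have h𝓓m : Measurable 𝓓 := measurable_pi_lambda _ hDm
  have h𝓑𝓓 : Measurable fun ω => (𝓑 ω, 𝓓 ω) := h𝓑m.prodMk h𝓓m
  have hKm : Measurable fun ω => count (𝓓 ω) k := (measurable_count k).comp h𝓓m
  set U : ℕ → Ω → ℝ≥0∞ := fun n ω => if count (𝓓 ω) k = n then φ (𝓑 ω, 𝓓 ω) else 0 with hU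
  have hUm : ∀ n, Measurable (U n) := fun n =>
    Measurable.ite (hKm (measurableSet_singleton n)) (hφ.comp h𝓑𝓓) measurable_const
  have hVm : ∀ m, Measurable fun ω => if D k ω = m then (1 : ℝ≥0∞) else 0 := fun m =>
    Measurable.ite (hDm k (measurableSet_singleton m)) measurable_const measurable_const
  set W : ℕ → ℕ → Ω → ℝ≥0∞ := fun n m ω => ∏ i ∈ Finset.Ico (n + 1) (n + m + 1), g (B i ω)
    with hW
  have hWm : ∀ n m, Measurable (W n m) := fun n m =>
    Finset.measurable_prod _ fun i _ => hg.comp (hBm i)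
  have hUsum : ∀ ω, ∑' n, U n ω = φ (𝓑 ω, 𝓓 ω) := fun ω => by
    simp only [hU]
    rw [tsum_eq_single (count (𝓓 ω) k) (fun n hn => if_neg (Ne.symm hn)), if_pos rfl]
  -- the three factors are independent
  have key : ∀ n m, ∫⁻ ω, U n ω * (if D k ω = m then 1 else 0) * W n m ω ∂P =
      (∫⁻ ω, U n ω ∂P) * (P {ω | D k ω = m} * (∫⁻ ω, g (B 0 ω) ∂P) ^ m) := by
    intro n m
    let S₁ := Finset.range (n + 1)
    let S₂ := Finset.Ico (n + 1) (n + m + 1)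
    let X₁ : Ω → (S₁ → ℝ) := fun ω i => B i ω
    let X₂ : Ω → (S₂ → ℝ) := fun ω i => B i ω
    let T₁ := Finset.range k
    let Y₁ : Ω → (T₁ → ℕ) := fun ω i => D i ω
    have hX₁ : Measurable X₁ := measurable_pi_lambda _ fun i => hBm i
    have hX₂ : Measurable X₂ := measurable_pi_lambda _ fun i => hBm i
    have hY₁ : Measurable Y₁ := measurable_pi_lambda _ fun i => hDm i
    have hX : IndepFun X₁ X₂ P := hB.indepFun_finset S₁ S₂ (by
      rw [Finset.disjoint_left]; intro i; simp [S₁, S₂]; omega) hBm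
    have hY : IndepFun Y₁ (D k) P := by
      have := hD.indepFun_finset T₁ {k} (by simp [T₁]) hDm
      exact this.comp (φ := id) (ψ := fun v : ({k} : Finset ℕ) → ℕ => v ⟨k, by simp⟩) measurable_id
        (by fun_prop)
    have hX2 : IndepFun X₂ (fun ω => (X₁ ω, 𝓓 ω)) P :=
      IndepFun.prodMk_of_prodMk hX₁ hX₂ h𝓓m hX
        (hBD.comp (φ := fun b => ((fun i : S₁ => b i), (fun i : S₂ => b i))) (ψ := id)
          (by fun_prop) measurable_id)
    have hY2 : IndepFun (D k) (fun ω => (Y₁ ω, X₁ ω)) P :=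
      IndepFun.prodMk_of_prodMk hY₁ (hDm k) hX₁ hY
        (hBD.symm.comp (φ := fun d => ((fun i : T₁ => d i), d k)) (ψ := fun b => fun i : S₁ => b i)
          (by fun_prop) (by fun_prop))
    -- the first factor is a function of the past
    let u : (S₁ → ℝ) × (T₁ → ℕ) → ℝ≥0∞ := fun p =>
      if count (extendFamily T₁ 0 p.2) k = n then
        φ (extendFamily S₁ 0 p.1, extendFamily T₁ 0 p.2) else 0
    have hum : Measurable u := by
      have h1 : Measurable fun p : (S₁ → ℝ) × (T₁ → ℕ) => extendFamily S₁ 0 p.1 :=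
        (measurable_extendFamily S₁ 0).comp measurable_fst
      have h2 : Measurable fun p : (S₁ → ℝ) × (T₁ → ℕ) => extendFamily T₁ 0 p.2 :=
        (measurable_extendFamily T₁ 0).comp measurable_snd
      exact Measurable.ite (((measurable_count k).comp h2) (measurableSet_singleton n))
        (hφ.comp (h1.prodMk h2)) measurable_const
    -- By `hφk` the default values outside `S₁` and `T₁` have no influence once the past count is
    -- `n`.
    have hUu : ∀ ω, U n ω = u (X₁ ω, Y₁ ω) := by
      intro ω
      have hc : ∀ j < k, 𝓓 ω j = extendFamily T₁ 0 (Y₁ ω) j := fun j hj => by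
        simp [extendFamily, T₁, hj, Y₁, h𝓓]
      have hc' := count_congr hc
      simp only [hU, u, ← hc']
      split_ifs with h
      · refine hφk _ _ _ _ hc fun i hi => ?_
        have : i < n + 1 := by omega
        simp [extendFamily, S₁, this, X₁, h𝓑]
      · rfl
    have e1 : ∫⁻ ω, U n ω * (if D k ω = m then 1 else 0) * W n m ω ∂P =
        (∫⁻ ω, U n ω * (if D k ω = m then 1 else 0) ∂P) * ∫⁻ ω, W n m ω ∂P := by
      refine lintegral_mul_eq_lintegral_mul_lintegral_of_indepFun ((hUm n).mul (hVm m)) (hWm n m) ?_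
      have := hX2.symm.comp
        (φ := fun p : (S₁ → ℝ) × (ℕ → ℕ) => u (p.1, fun i => p.2 i) * (if p.2 k = m then 1 else 0))
        (ψ := fun v : S₂ → ℝ => ∏ i, g (v i))
        (Measurable.mul (hum.comp (by fun_prop)) ((measurable_of_countable
          fun j => if j = m then (1 : ℝ≥0∞) else 0).comp (by fun_prop)))
        (Finset.measurable_prod _ fun i _ => hg.comp (measurable_pi_apply i))
      convert this using 1
      · ext ω; simp [hUu]; rfl
      · ext ω
        exact (Finset.prod_coe_sort S₂ (fun i => g (B i ω))).symm
    have e2 : ∫⁻ ω, U n ω * (if D k ω = m then 1 else 0) ∂P =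
        (∫⁻ ω, U n ω ∂P) * ∫⁻ ω, (if D k ω = m then 1 else 0) ∂P := by
      refine lintegral_mul_eq_lintegral_mul_lintegral_of_indepFun (hUm n) (hVm m) ?_
      have := hY2.symm.comp (φ := fun p : (T₁ → ℕ) × (S₁ → ℝ) => u p.swap) (ψ := fun j => if j = m then (1 : ℝ≥0∞) else 0)
        (hum.comp measurable_swap) (measurable_of_countable _)
      convert this using 1
      · ext ω; simp [hUu]
      · rfl
    have e3 : ∫⁻ ω, (if D k ω = m then (1 : ℝ≥0∞) else 0) ∂P = P {ω | D k ω = m} := by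
      have hS : MeasurableSet {ω | D k ω = m} := hDm k (measurableSet_singleton m)
      rw [← lintegral_indicator_one hS]
      exact lintegral_congr fun ω => by simp [Set.indicator]
    have e4 : ∫⁻ ω, W n m ω ∂P = (∫⁻ ω, g (B 0 ω) ∂P) ^ m := by
      have hi := hB.comp (fun _ => g) (fun _ => hg)
      have hS := hi.precomp (g := fun i : S₂ => (i : ℕ)) Subtype.val_injective
      have := lintegral_prod_eq_prod_lintegral_of_indepFun (Finset.univ : Finset S₂)
        (fun i => g ∘ B i) hS (fun i => hg.comp (hBm i))
      calc ∫⁻ ω, W n m ω ∂P = ∫⁻ ω, ∏ i : S₂, (g ∘ B i) ω ∂P := by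
            refine lintegral_congr fun ω => ?_
            exact (Finset.prod_coe_sort S₂ (fun i => g (B i ω))).symm
        _ = ∏ i : S₂, ∫⁻ ω, (g ∘ B i) ω ∂P := this
        _ = ∏ i : S₂, ∫⁻ ω, g (B 0 ω) ∂P :=
            Finset.prod_congr rfl fun i _ => ((hBi i).comp hg).lintegral_eq
        _ = _ := by simp [S₂]
    rw [e1, e2, e3, e4, mul_assoc]
  have expand : ∀ ω, φ (𝓑 ω, 𝓓 ω) *
      ∏ i ∈ Finset.Ico (count (𝓓 ω) k + 1) (count (𝓓 ω) (k + 1) + 1), g (B i ω) =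
      ∑' n, ∑' m, U n ω * (if D k ω = m then 1 else 0) * W n m ω := by
    intro ω
    rw [tsum_eq_single (count (𝓓 ω) k), tsum_eq_single (D k ω)]
    · simp [hU, hW, count_succ, h𝓓]
    · intro m hm; simp [Ne.symm hm]
    · intro n hn; simp [hU, Ne.symm hn]
  have hm : ∀ n m, Measurable fun ω => U n ω * (if D k ω = m then 1 else 0) * W n m ω :=
    fun n m => ((hUm n).mul (hVm m)).mul (hWm n m)
  calc _ = ∫⁻ ω, ∑' n, ∑' m, U n ω * (if D k ω = m then 1 else 0) * W n m ω ∂P :=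
        lintegral_congr expand
    _ = ∑' n, ∑' m, ∫⁻ ω, U n ω * (if D k ω = m then 1 else 0) * W n m ω ∂P := by
        rw [lintegral_tsum fun n => (Measurable.tsum fun m => hm n m).aemeasurable]
        exact tsum_congr fun n => lintegral_tsum fun m => (hm n m).aemeasurable
    _ = _ := by
        simp_rw [key, ENNReal.tsum_mul_left, ENNReal.tsum_mul_right]
        rw [← lintegral_tsum fun n => (hUm n).aemeasurable]
        simp_rw [hUsum]
        rfl

/-- The generating function of the Poisson distribution. -/
theorem tsum_poissonMeasure_mul_pow (r : ℝ≥0) {γ : ℝ} (hγ : 0 ≤ γ) :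
    ∑' m, poissonMeasure r {m} * ENNReal.ofReal γ ^ m =
      ENNReal.ofReal (Real.exp (r * (γ - 1))) := by
  have hs : HasSum (fun m : ℕ => Real.exp (-r) * ((r * γ) ^ m / m.factorial))
      (Real.exp (-r) * Real.exp (r * γ)) := by
    have := NormedSpace.expSeries_div_hasSum_exp (r * γ : ℝ)
    rw [← Real.exp_eq_exp_ℝ] at this
    exact this.mul_left _
  have he : Real.exp (r * (γ - 1)) = Real.exp (-r) * Real.exp (r * γ) := by
    rw [← Real.exp_add]; congr 1; ring
  rw [he, ← hs.tsum_eq, ENNReal.ofReal_tsum_of_nonneg (fun m => by positivity) hs.summable]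
  refine tsum_congr fun m => ?_
  rw [poissonMeasure_singleton, ← ENNReal.ofReal_pow hγ, ← ENNReal.ofReal_mul (by positivity),
    mul_pow]
  congr 1; ring

end ProbabilityTheory

/-! ### Sample paths, the hitting time and its grid approximation. -/

section Path

variable {Ω : Type*} {B : ℕ → Ω → ℝ} {N : ℝ≥0 → Ω → ℕ} {ρ : ℝ≥0} {ω : Ω}

theorem exists_forall_lt_eq_of_continuousWithinAt {n : ℝ≥0 → ℕ} {s : ℝ≥0}
    (hn : ContinuousWithinAt n (Set.Ici (ρ * s)) (ρ * s)) :
    ∃ u, s < u ∧ ∀ t, s ≤ t → t < u → n (ρ * t) = n (ρ * s) := by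
  have hc : ContinuousWithinAt (fun t => n (ρ * t)) (Set.Ici s) s :=
    ContinuousWithinAt.comp (f := fun t => ρ * t) hn (by fun_prop)
      fun t ht => mul_le_mul_right ht ρ
  have he : ∀ᶠ t in 𝓝[≥] s, n (ρ * t) ∈ ({n (ρ * s)} : Set ℕ) :=
    hc.eventually ((isOpen_discrete _).mem_nhds rfl)
  obtain ⟨u, hu, hsub⟩ := mem_nhdsGE_iff_exists_Ico_subset.1 he
  exact ⟨u, hu, fun t h1 h2 => hsub ⟨h1, h2⟩⟩

theorem compoundPoisson_sub_le (hmono : Monotone fun t => N t ω) (hB : ∀ i, 0 < B i ω) {v s : ℝ≥0}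
    (h : v ≤ s) :
    compoundPoisson B N ρ v ω - (s - v) ≤ compoundPoisson B N ρ s ω := by
  have hN : N (ρ * v) ω ≤ N (ρ * s) ω := hmono (mul_le_mul_right h ρ)
  have := Finset.sum_le_sum_of_subset_of_nonneg (f := fun i => B i ω)
    (Finset.Icc_subset_Icc_right hN : Finset.Icc 1 (N (ρ * v) ω) ⊆ _) fun i _ _ => (hB i).le
  unfold compoundPoisson
  linarith

/-- If the compound Poisson process becomes nonpositive, then its first hitting time of zero is
finite and attained, the process is positive before that time, and there are no jumps immediately
after it. -/
theorem exists_hitZero_eq (hmono : Monotone fun t => N t ω) (h0 : N 0 ω = 0)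
    (hrc : ∀ t, ContinuousWithinAt (fun s => N s ω) (Set.Ici t) t) (hB : ∀ i, 0 < B i ω)
    (hX : ∃ t, compoundPoisson B N ρ t ω ≤ 0) :
    ∃ s : ℝ≥0, compoundPoisson B N ρ s ω = 0 ∧ (∀ t < s, 0 < compoundPoisson B N ρ t ω) ∧
      hitZero B N ρ ω = s ∧ ∃ u, s < u ∧ ∀ t, s ≤ t → t < u → N (ρ * t) ω = N (ρ * s) ω := by
  set S : Set ℝ≥0 := {t | compoundPoisson B N ρ t ω ≤ 0} with hS
  set s := sInf S with hs
  obtain ⟨u, hu, hconst⟩ := exists_forall_lt_eq_of_continuousWithinAt (hrc (ρ * s))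
  have hpos : ∀ t < s, 0 < compoundPoisson B N ρ t ω := fun t ht => by
    by_contra! h
    exact absurd (csInf_le' (show t ∈ S from h)) (not_le.2 ht)
  -- From a positive level at `s` the drift needs that much time to reach zero, as no jump occurs
  -- before `u`; this contradicts the infimum.
  have hle : compoundPoisson B N ρ s ω ≤ 0 := by
    by_contra! h
    have hlt : s < min u (s + (compoundPoisson B N ρ s ω).toNNReal) :=
      lt_min hu (lt_add_of_pos_right _ (Real.toNNReal_pos.2 h))
    obtain ⟨t, htS, ht⟩ := exists_lt_of_csInf_lt (show S.Nonempty from hX) hlt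
    have hst : s ≤ t := csInf_le' htS
    have e := hconst t hst (ht.trans_le (min_le_left _ _))
    have ht' : t < s + (compoundPoisson B N ρ s ω).toNNReal := ht.trans_le (min_le_right _ _)
    have ht2 : (t : ℝ) < s + compoundPoisson B N ρ s ω := by
      have := NNReal.coe_lt_coe.2 ht'
      rwa [NNReal.coe_add, Real.coe_toNNReal _ h.le] at this
    have htS' : compoundPoisson B N ρ t ω ≤ 0 := htS
    unfold compoundPoisson at htS' ht2
    simp only [e] at htS'
    linarith
  -- The path falls at speed at most one, so a negative level at `s` would force a nonpositive level
  -- already at `v < s`.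
  have hge : 0 ≤ compoundPoisson B N ρ s ω := by
    by_contra! h
    have hs0 : s ≠ 0 := by
      intro h0s
      have : compoundPoisson B N ρ s ω = B 0 ω := by simp [compoundPoisson, h0s, h0]
      linarith [hB 0]
    have hs0' : (0 : ℝ) < s := NNReal.coe_pos.2 (pos_iff_ne_zero.2 hs0)
    set v : ℝ≥0 := (s + compoundPoisson B N ρ s ω).toNNReal with hv
    have hvs : v < s := by
      rw [hv, ← NNReal.coe_lt_coe, Real.coe_toNNReal']
      exact max_lt (by linarith) hs0'
    have h1 := hpos v hvs
    have h2 := compoundPoisson_sub_le (ρ := ρ) hmono hB hvs.le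
    have h3 : (s : ℝ) + compoundPoisson B N ρ s ω ≤ v := Real.le_coe_toNNReal _
    linarith
  refine ⟨s, le_antisymm hle hge, hpos, ?_, u, hu, hconst⟩
  refine le_antisymm (iInf₂_le (f := fun (t : ℝ≥0)
    (_ : compoundPoisson B N ρ t ω = 0) => (t : ℝ≥0∞)) s (le_antisymm hle hge)) (le_iInf₂ fun t ht => ?_)
  exact ENNReal.coe_le_coe.2 (csInf_le' (show t ∈ S from (le_of_eq ht)))

theorem hitZero_eq_top (hX : ¬ ∃ t, compoundPoisson B N ρ t ω ≤ 0) : hitZero B N ρ ω = ⊤ := by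
  push Not at hX
  simp only [hitZero, iInf_eq_top]
  exact fun t ht => absurd ht (hX t).ne'

/-- On the grid with step `h`, the process becomes nonpositive, and all jumps up to the first such
grid point are at most `x`. -/
def gridEvent (B : ℕ → Ω → ℝ) (N : ℝ≥0 → Ω → ℕ) (ρ h : ℝ≥0) (x : ℝ) : Set Ω :=
  {ω | ∃ k : ℕ, (∀ j < k, 0 < compoundPoisson B N ρ (j * h) ω) ∧
    compoundPoisson B N ρ (k * h) ω ≤ 0 ∧ ∀ i ≤ N (ρ * (k * h)) ω, B i ω ≤ x}

/-- The first grid point at or after `s` lies in `[s, u)`, where `N` is constant: the same jumps are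
counted, and the drift makes the level nonpositive. -/
theorem mem_gridEvent_iff (hmono : Monotone fun t => N t ω) {s u h : ℝ≥0} {x : ℝ}
    (hs : compoundPoisson B N ρ s ω = 0) (hpos : ∀ t < s, 0 < compoundPoisson B N ρ t ω)
    (hτ : hitZero B N ρ ω = s) (hu : ∀ t, s ≤ t → t < u → N (ρ * t) ω = N (ρ * s) ω)
    (hh : 0 < h) (hsu : s + h ≤ u) :
    ω ∈ gridEvent B N ρ h x ↔ largestJump B N ρ ω ≤ x := by
  set k := ⌈s / h⌉₊ with hk
  have hlt : ∀ j < k, 0 < compoundPoisson B N ρ (j * h) ω := fun j hj =>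
    hpos _ ((lt_div_iff₀ hh).1 (Nat.lt_ceil.1 hj))
  have hsk : s ≤ k * h := (div_le_iff₀ hh).1 (Nat.le_ceil _)
  have hku : k * h < u := by
    refine lt_of_lt_of_le ?_ hsu
    have := Nat.ceil_lt_add_one (zero_le (a := s / h))
    calc k * h < (s / h + 1) * h := mul_lt_mul_of_pos_right this hh
      _ = s + h := by field_simp
  have hN : N (ρ * (k * h)) ω = N (ρ * s) ω := hu _ hsk hku
  have hXk : compoundPoisson B N ρ (k * h) ω ≤ 0 := by
    have : (s : ℝ) ≤ ((k * h : ℝ≥0) : ℝ) := NNReal.coe_le_coe.2 hsk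
    unfold compoundPoisson at hs ⊢
    rw [hN]
    linarith
  have hJ : largestJump B N ρ ω ≤ x ↔ ∀ i ≤ N (ρ * s) ω, B i ω ≤ x := by
    simp only [largestJump, iSup_le_iff, EReal.coe_le_coe_iff, hτ, ENNReal.coe_le_coe]
    constructor
    · exact fun H i hi => H i ⟨s, le_rfl, hi⟩
    · rintro H i ⟨t, ht, hi⟩
      exact H i (hi.trans (hmono (mul_le_mul_right ht ρ)))
  rw [hJ, ← hN]
  constructor
  · rintro ⟨k', h1, h2, h3⟩
    have : k' = k := by
      refine le_antisymm ?_ ?_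
      · by_contra! hc
        exact absurd (h1 k hc) (not_lt.2 hXk)
      · by_contra! hc
        exact absurd (hlt k' hc) (not_lt.2 h2)
    exact this ▸ h3
  · exact fun H => ⟨k, hlt, hXk, H⟩

theorem le_of_largestJump_le {x : ℝ} (hτ : hitZero B N ρ ω = ⊤) (h : largestJump B N ρ ω ≤ x)
    {t : ℝ≥0} {i : ℕ} (hi : i ≤ N (ρ * t) ω) : B i ω ≤ x := by
  simp only [largestJump, iSup_le_iff, EReal.coe_le_coe_iff, hτ] at h
  exact h i ⟨t, le_top, hi⟩

end Path

/-! ### The random walk on the grid and its exponential weights. -/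

namespace ProbabilityTheory

/-- The level of the random walk `∑_{i ≤ K_k} b i - k h`, where `K_k = ∑_{j < k} d j`. -/
noncomputable def gridLevel (h : ℝ) (k : ℕ) (p : (ℕ → ℝ) × (ℕ → ℕ)) : ℝ :=
  ∑ i ∈ Finset.range (count p.2 k + 1), p.1 i - k * h

/-- The paths that are positive up to step `k`. -/
def positivePaths (h : ℝ) (k : ℕ) : Set ((ℕ → ℝ) × (ℕ → ℕ)) := {p | ∀ j ≤ k, 0 < gridLevel h j p}

/-- The paths whose jumps up to step `k` are at most `x`. -/
def boundedPaths (x : ℝ) (k : ℕ) : Set ((ℕ → ℝ) × (ℕ → ℕ)) := {p | ∀ i ≤ count p.2 k, p.1 i ≤ x}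

/-- The product of the weights `g (b i)` of the jumps up to step `k`. -/
noncomputable def pathWeight (g : ℝ → ℝ≥0∞) (k : ℕ) (p : (ℕ → ℝ) × (ℕ → ℕ)) : ℝ≥0∞ :=
  ∏ i ∈ Finset.range (count p.2 k + 1), g (p.1 i)

/-- The exponential weight of a jump, truncated at `x`. -/
noncomputable def expWeight (θ x b : ℝ) : ℝ≥0∞ := if b ≤ x then ENNReal.ofReal (Real.exp (-θ * b)) else 0

theorem measurable_comp_count {γ : Type*} [MeasurableSpace γ] {f : (ℕ → ℝ) → ℕ → γ}
    (hf : ∀ n, Measurable fun b => f b n) (k : ℕ) :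
    Measurable fun p : (ℕ → ℝ) × (ℕ → ℕ) => f p.1 (count p.2 k) := by
  have h : Measurable fun q : (ℕ → ℝ) × ℕ => f q.1 q.2 := measurable_from_prod_countable_left hf
  exact h.comp (measurable_fst.prodMk ((measurable_count k).comp measurable_snd))

theorem measurable_gridLevel (h : ℝ) (k : ℕ) : Measurable (gridLevel h k) :=
  measurable_comp_count (f := fun b n => ∑ i ∈ Finset.range (n + 1), b i - k * h)
    (fun n => by fun_prop) k

theorem measurableSet_positivePaths (h : ℝ) (k : ℕ) : MeasurableSet (positivePaths h k) := by
  simp only [positivePaths, Set.ofPred_forall]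
  exact MeasurableSet.iInter fun j => MeasurableSet.iInter fun _ =>
    measurableSet_lt measurable_const (measurable_gridLevel h j)

theorem measurableSet_boundedPaths (x : ℝ) (k : ℕ) : MeasurableSet (boundedPaths x k) := by
  have h : Measurable fun p : (ℕ → ℝ) × (ℕ → ℕ) => ∀ i ≤ count p.2 k, p.1 i ≤ x :=
    measurable_comp_count (f := fun b n => ∀ i ≤ n, b i ≤ x) (fun n => by
      refine measurableSet_setOfPred.1 ?_
      simp only [Set.ofPred_forall]
      exact MeasurableSet.iInter fun j => MeasurableSet.iInter fun _ =>
        measurableSet_le (measurable_pi_apply j) measurable_const) k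
  exact measurableSet_setOfPred.2 h

theorem measurable_pathWeight {g : ℝ → ℝ≥0∞} (hg : Measurable g) (k : ℕ) :
    Measurable (pathWeight g k) :=
  measurable_comp_count (f := fun b n => ∏ i ∈ Finset.range (n + 1), g (b i))
    (fun _ => Finset.measurable_prod _ fun i _ => hg.comp (measurable_pi_apply i)) k

theorem measurable_expWeight (θ x : ℝ) : Measurable (expWeight θ x) :=
  Measurable.ite measurableSet_Iic (by fun_prop) measurable_const

theorem dependsOnPast_pathWeight (g : ℝ → ℝ≥0∞) (k : ℕ) : DependsOnPast k (pathWeight g k) := by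
  intro b b' d d' hd hb
  simp only [pathWeight, ← count_congr hd]
  exact Finset.prod_congr rfl fun i hi => by rw [hb i (Nat.lt_succ_iff.1 (Finset.mem_range.1 hi))]

theorem dependsOnPast_gridLevel (h : ℝ) (k : ℕ) : DependsOnPast k (gridLevel h k) := by
  intro b b' d d' hd hb
  simp only [gridLevel, ← count_congr hd]
  congr 1
  exact Finset.sum_congr rfl fun i hi => hb i (Nat.lt_succ_iff.1 (Finset.mem_range.1 hi))

theorem mem_positivePaths_congr {h : ℝ} {k : ℕ} {b b' : ℕ → ℝ} {d d' : ℕ → ℕ}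
    (hd : ∀ j < k, d j = d' j) (hb : ∀ i ≤ count d k, b i = b' i) :
    (b, d) ∈ positivePaths h k ↔ (b', d') ∈ positivePaths h k := by
  refine forall₂_congr fun j hj => ?_
  rw [dependsOnPast_gridLevel h j b b' d d' (fun i hi => hd i (hi.trans_le hj))
    fun i hi => hb i (hi.trans (count_mono d hj))]

theorem pathWeight_succ (g : ℝ → ℝ≥0∞) (k : ℕ) (p : (ℕ → ℝ) × (ℕ → ℕ)) :
    pathWeight g (k + 1) p = pathWeight g k p *
      ∏ i ∈ Finset.Ico (count p.2 k + 1) (count p.2 (k + 1) + 1), g (p.1 i) :=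
  (Finset.prod_range_mul_prod_Ico _ (Nat.succ_le_succ (count_mono p.2 k.le_succ))).symm

/-- Identifies the product of weights, which factorizes over steps, with the killed exponential of
the level, to which optional stopping applies. -/
theorem pathWeight_expWeight (θ x h : ℝ) (k : ℕ) (p : (ℕ → ℝ) × (ℕ → ℕ)) :
    ENNReal.ofReal (Real.exp (θ * h)) ^ k * pathWeight (expWeight θ x) k p =
      (boundedPaths x k).indicator (fun p => ENNReal.ofReal (Real.exp (-θ * gridLevel h k p))) p := by
  have hprod : pathWeight (expWeight θ x) k p =
      if ∀ i ∈ Finset.range (count p.2 k + 1), p.1 i ≤ x then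
        ∏ i ∈ Finset.range (count p.2 k + 1), ENNReal.ofReal (Real.exp (-θ * p.1 i)) else 0 :=
    Finset.prod_ite_zero
  have hiff : (∀ i ∈ Finset.range (count p.2 k + 1), p.1 i ≤ x) ↔ p ∈ boundedPaths x k := by
    simp [boundedPaths]
  rw [hprod]
  by_cases hp : p ∈ boundedPaths x k
  swap
  · rw [if_neg (mt hiff.1 hp), Set.indicator_of_notMem hp, mul_zero]
  rw [if_pos (hiff.2 hp), Set.indicator_of_mem hp,
    ← ENNReal.ofReal_prod_of_nonneg fun i _ => (Real.exp_pos _).le, ← Real.exp_sum,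
    ← ENNReal.ofReal_pow (Real.exp_pos _).le, ← Real.exp_nat_mul,
    ← ENNReal.ofReal_mul (Real.exp_pos _).le, ← Real.exp_add, ← Finset.mul_sum, gridLevel]
  congr 2; ring

theorem gridLevel_succ_ge {h : ℝ} {k : ℕ} {p : (ℕ → ℝ) × (ℕ → ℕ)} (hp : ∀ i, 0 < p.1 i) :
    gridLevel h k p - h ≤ gridLevel h (k + 1) p := by
  have := Finset.sum_le_sum_of_subset_of_nonneg (f := p.1) (Finset.range_mono
    (Nat.succ_le_succ (count_mono p.2 k.le_succ))) fun i _ _ => (hp i).le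
  unfold gridLevel
  push_cast
  linarith

/-! ### Optional stopping on the grid. -/

/-- A sequence of independent identically distributed positive jumps and an independent sequence of
independent Poisson distributed counts. -/
structure IsPoissonGrid {Ω : Type*} [MeasurableSpace Ω] (B : ℕ → Ω → ℝ) (D : ℕ → Ω → ℕ) (r : ℝ≥0)
    (P : Measure Ω) : Prop where
  measurable_jump : ∀ i, Measurable (B i)
  measurable_count : ∀ j, Measurable (D j)
  indep_jump : iIndepFun B P
  ident_jump : ∀ i, IdentDistrib (B i) (B 0) P P
  pos_jump : ∀ᵐ ω ∂P, ∀ i, 0 < B i ω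
  indep_count : iIndepFun D P
  law_count : ∀ j, HasLaw (D j) (poissonMeasure r) P
  indep : IndepFun (fun ω i => B i ω) (fun ω j => D j ω) P

/-- The path of jumps and counts. -/
def gridPath {Ω : Type*} (B : ℕ → Ω → ℝ) (D : ℕ → Ω → ℕ) (ω : Ω) : (ℕ → ℝ) × (ℕ → ℕ) :=
  (fun i => B i ω, fun j => D j ω)

namespace IsPoissonGrid

variable {Ω : Type*} [MeasurableSpace Ω] {P : Measure Ω}
  {B : ℕ → Ω → ℝ} {D : ℕ → Ω → ℕ} {r : ℝ≥0}

theorem measurable_gridPath (H : IsPoissonGrid B D r P) : Measurable (gridPath B D) :=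
  (measurable_pi_lambda _ H.measurable_jump).prodMk (measurable_pi_lambda _ H.measurable_count)

variable [IsProbabilityMeasure P]

theorem lintegral_mul_pathWeight_succ (H : IsPoissonGrid B D r P) {g : ℝ → ℝ≥0∞}
    (hg : Measurable g) {γ : ℝ} (hγ : 0 ≤ γ) (hgγ : ∫⁻ ω, g (B 0 ω) ∂P = ENNReal.ofReal γ)
    (k : ℕ) {A : Set ((ℕ → ℝ) × (ℕ → ℕ))} (hA : MeasurableSet A)
    (hAk : DependsOnPast k (A.indicator fun _ => (1 : ℝ≥0∞))) :
    ∫⁻ ω, A.indicator (pathWeight g (k + 1)) (gridPath B D ω) ∂P =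
      (∫⁻ ω, A.indicator (pathWeight g k) (gridPath B D ω) ∂P) *
        ENNReal.ofReal (Real.exp (r * (γ - 1))) := by
  have hφ : Measurable (A.indicator (pathWeight g k)) := (measurable_pathWeight hg k).indicator hA
  have hmul : ∀ f : (ℕ → ℝ) × (ℕ → ℕ) → ℝ≥0∞, ∀ p,
      A.indicator f p = A.indicator (fun _ => (1 : ℝ≥0∞)) p * f p := fun f p => by
    by_cases hp : p ∈ A <;> simp [hp]
  have hφk : DependsOnPast k (A.indicator (pathWeight g k)) := fun b b' d d' hd hb => by
    rw [hmul, hmul (pathWeight g k) (b', d'), hAk b b' d d' hd hb, dependsOnPast_pathWeight g k b b' d d' hd hb]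
  have := lintegral_mul_prod_Ico H.measurable_jump H.measurable_count H.indep_jump H.ident_jump
    H.indep_count H.indep hg hφ hφk
  have hlaw : ∀ m, P {ω | D k ω = m} = poissonMeasure r {m} := fun m =>
    (H.law_count k).measure_eq (measurableSet_singleton m)
  simp_rw [hgγ, hlaw] at this
  rw [tsum_poissonMeasure_mul_pow r hγ] at this
  refine Eq.trans ?_ this
  refine lintegral_congr fun ω => ?_
  rw [hmul, pathWeight_succ, ← mul_assoc, ← hmul (pathWeight g k)]
  rfl

/-- For `θ = 0` the weight of a path is the indicator of all jumps being at most `x`, so its mean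
shrinks by the same factor `exp(r (γ - 1)) < 1` in each step. -/
theorem tendsto_measure_boundedPaths (H : IsPoissonGrid B D r P) (hr : 0 < r) {x : ℝ}
    (hx : P {ω | B 0 ω ≤ x} < 1) :
    Tendsto (fun k => P (gridPath B D ⁻¹' boundedPaths x k)) atTop (𝓝 0) := by
  set γ := P.real {ω | B 0 ω ≤ x} with hγ
  have hγ1 : γ < 1 := by
    have := (ENNReal.toReal_lt_toReal (measure_ne_top _ _) ENNReal.one_ne_top).2 hx
    simpa [hγ, measureReal_def] using this
  have hxm : MeasurableSet {ω | B 0 ω ≤ x} := measurableSet_le (H.measurable_jump 0) measurable_const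
  have hg : Measurable (expWeight 0 x) := measurable_expWeight 0 x
  have hgγ : ∫⁻ ω, expWeight 0 x (B 0 ω) ∂P = ENNReal.ofReal γ := by
    rw [hγ, ofReal_measureReal, ← lintegral_indicator_one hxm]
    exact lintegral_congr fun ω => by simp [expWeight, Set.indicator]
  have hw : ∀ k, ∫⁻ ω, pathWeight (expWeight 0 x) k (gridPath B D ω) ∂P =
      P (gridPath B D ⁻¹' boundedPaths x k) := fun k => by
    rw [← lintegral_indicator_one (H.measurable_gridPath (measurableSet_boundedPaths x k))]
    refine lintegral_congr fun ω => ?_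
    have := pathWeight_expWeight 0 x 0 k (gridPath B D ω)
    simp only [zero_mul, Real.exp_zero, neg_zero, ENNReal.ofReal_one, one_pow, one_mul] at this
    rw [this]; rfl
  set c := ENNReal.ofReal (Real.exp (r * (γ - 1))) with hc
  have hc1 : c < 1 := by
    rw [hc, ENNReal.ofReal_lt_one, Real.exp_lt_one_iff]
    exact mul_neg_of_pos_of_neg hr (by linarith)
  have hstep : ∀ k, P (gridPath B D ⁻¹' boundedPaths x (k + 1)) =
      P (gridPath B D ⁻¹' boundedPaths x k) * c := fun k => by
    have := H.lintegral_mul_pathWeight_succ hg measureReal_nonneg hgγ k MeasurableSet.univ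
      (fun _ _ _ _ _ _ => by simp)
    simpa only [Set.indicator_univ, hw] using this
  have hpow : ∀ k, P (gridPath B D ⁻¹' boundedPaths x k) ≤ c ^ k := fun k => by
    induction k with
    | zero => simpa using prob_le_one
    | succ k ih => rw [hstep, pow_succ]; gcongr
  exact tendsto_of_tendsto_of_tendsto_of_le_of_le tendsto_const_nhds
    (ENNReal.tendsto_pow_atTop_nhds_zero_of_lt_one hc1) (fun _ => zero_le) hpow

/-- The event that the walk first becomes nonpositive at step `k + 1`, with all jumps up to then at
most `x`. -/
def _root_.ProbabilityTheory.exitPaths (h x : ℝ) (k : ℕ) : Set ((ℕ → ℝ) × (ℕ → ℕ)) :=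
  (positivePaths h k \ positivePaths h (k + 1)) ∩ boundedPaths x (k + 1)

theorem _root_.ProbabilityTheory.measurableSet_exitPaths (h x : ℝ) (k : ℕ) :
    MeasurableSet (exitPaths h x k) :=
  ((measurableSet_positivePaths h k).diff (measurableSet_positivePaths h (k + 1))).inter
    (measurableSet_boundedPaths x (k + 1))

/-- Optional stopping for the exponential martingale of the walk. -/
theorem lintegral_expWeight_eq (H : IsPoissonGrid B D r P) {x h γ θ : ℝ} (hγ : 0 ≤ γ)
    (hgγ : ∫⁻ ω, expWeight θ x (B 0 ω) ∂P = ENNReal.ofReal γ) (hθ : θ * h = r * (1 - γ)) (n : ℕ) :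
    ENNReal.ofReal γ =
      ∫⁻ ω, (positivePaths h n).indicator ((boundedPaths x n).indicator
        fun p => ENNReal.ofReal (Real.exp (-θ * gridLevel h n p))) (gridPath B D ω) ∂P +
      ∑ k ∈ Finset.range n, ∫⁻ ω, (exitPaths h x k).indicator
        (fun p => ENNReal.ofReal (Real.exp (-θ * gridLevel h (k + 1) p))) (gridPath B D ω) ∂P := by
  set C := ENNReal.ofReal (Real.exp (θ * h)) with hC
  set M : ℕ → (ℕ → ℝ) × (ℕ → ℕ) → ℝ≥0∞ := fun k => (boundedPaths x k).indicator
    fun p => ENNReal.ofReal (Real.exp (-θ * gridLevel h k p)) with hM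
  have hMw : ∀ k p, M k p = C ^ k * pathWeight (expWeight θ x) k p := fun k p =>
    (pathWeight_expWeight θ x h k p).symm
  have hg := measurable_expWeight θ x
  have hMm : ∀ k, Measurable (M k) := fun k => by
    have : M k = fun p => C ^ k * pathWeight (expWeight θ x) k p := funext (hMw k)
    rw [this]
    exact (measurable_pathWeight hg k).const_mul _
  have hind : ∀ k l, ∀ ω, (positivePaths h k).indicator (M l) (gridPath B D ω) =
      C ^ l * (positivePaths h k).indicator (pathWeight (expWeight θ x) l) (gridPath B D ω) := by
    intro k l ω
    by_cases hp : gridPath B D ω ∈ positivePaths h k <;> simp [hp, hMw]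
  have hmart : ∀ k, ∫⁻ ω, (positivePaths h k).indicator (M (k + 1)) (gridPath B D ω) ∂P =
      ∫⁻ ω, (positivePaths h k).indicator (M k) (gridPath B D ω) ∂P := fun k => by
    have hAm := measurableSet_positivePaths h k
    simp_rw [hind]
    have hm : ∀ l, Measurable fun ω => (positivePaths h k).indicator
        (pathWeight (expWeight θ x) l) (gridPath B D ω) := fun l =>
      ((measurable_pathWeight hg l).indicator hAm).comp H.measurable_gridPath
    rw [lintegral_const_mul _ (hm _), lintegral_const_mul _ (hm _),
      H.lintegral_mul_pathWeight_succ hg hγ hgγ k hAm fun b b' d d' hd hb => by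
        have hiff := mem_positivePaths_congr (h := h) hd hb
        by_cases hp : (b, d) ∈ positivePaths h k
        · rw [Set.indicator_of_mem hp, Set.indicator_of_mem (hiff.1 hp)]
        · rw [Set.indicator_of_notMem hp, Set.indicator_of_notMem (mt hiff.2 hp)]]
    -- The martingale property: `hθ` is the choice of `θ` for which drift and Poisson factor cancel.
    have hCc : C * ENNReal.ofReal (Real.exp (r * (γ - 1))) = 1 := by
      rw [hC, ← ENNReal.ofReal_mul (Real.exp_pos _).le, ← Real.exp_add, hθ]
      simp [← mul_add]
    rw [pow_succ, mul_assoc, mul_left_comm C, hCc, mul_one]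
  have hsplit : ∀ k, ∫⁻ ω, (positivePaths h k).indicator (M (k + 1)) (gridPath B D ω) ∂P =
      ∫⁻ ω, (positivePaths h (k + 1)).indicator (M (k + 1)) (gridPath B D ω) ∂P +
      ∫⁻ ω, (exitPaths h x k).indicator
        (fun p => ENNReal.ofReal (Real.exp (-θ * gridLevel h (k + 1) p))) (gridPath B D ω) ∂P := by
    intro k
    have hm : Measurable fun ω => (positivePaths h (k + 1)).indicator (M (k + 1))
        (gridPath B D ω) :=
      ((hMm (k + 1)).indicator (measurableSet_positivePaths h (k + 1))).comp H.measurable_gridPath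
    rw [← lintegral_add_left hm]
    refine lintegral_congr fun ω => ?_
    have hsub : positivePaths h (k + 1) ⊆ positivePaths h k :=
      fun p hp j hj => hp j (hj.trans k.le_succ)
    generalize gridPath B D ω = p
    by_cases h1 : p ∈ positivePaths h (k + 1)
    · simp [h1, hsub h1, exitPaths]
    · by_cases h2 : p ∈ positivePaths h k <;> by_cases h3 : p ∈ boundedPaths x (k + 1) <;>
        simp [h1, h2, h3, exitPaths, hM]
  -- The initial mean is that of the weight of `B 0`, namely `γ`; each step then splits off one exit
  -- term.
  induction n with
  | zero =>
    simp only [Finset.range_zero, Finset.sum_empty, add_zero]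
    rw [← hgγ]
    refine lintegral_congr_ae ?_
    filter_upwards [H.pos_jump] with ω hω
    have h1 : gridPath B D ω ∈ positivePaths h 0 := by
      intro j hj
      obtain rfl : j = 0 := by omega
      simpa [gridLevel, count, gridPath] using hω 0
    have h2 := hMw 0 (gridPath B D ω)
    rw [Set.indicator_of_mem h1]
    simp only [hM] at h2
    rw [h2]
    simp [pathWeight, count, gridPath]
  | succ n ih =>
    rw [ih, Finset.sum_range_succ, ← hmart n, hsplit n]
    ring

/-- The probability of an exit with all jumps at most `x`, up to the overshoot at the exit. -/
theorem measure_iUnion_exitPaths (H : IsPoissonGrid B D r P) (hr : 0 < r) {x h γ θ : ℝ}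
    (hγ : 0 ≤ γ) (hgγ : ∫⁻ ω, expWeight θ x (B 0 ω) ∂P = ENNReal.ofReal γ)
    (hθ : θ * h = r * (1 - γ)) (hθ0 : 0 ≤ θ) (hx : P {ω | B 0 ω ≤ x} < 1) :
    P (gridPath B D ⁻¹' ⋃ k, exitPaths h x k) ≤ ENNReal.ofReal γ ∧
      ENNReal.ofReal γ ≤ ENNReal.ofReal (Real.exp (θ * h)) *
        P (gridPath B D ⁻¹' ⋃ k, exitPaths h x k) := by
  have hm : ∀ k, MeasurableSet (gridPath B D ⁻¹' exitPaths h x k) := fun k =>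
    H.measurable_gridPath (measurableSet_exitPaths h x k)
  have hdisj : Pairwise (Function.onFun Disjoint fun k => gridPath B D ⁻¹' exitPaths h x k) := by
    have : ∀ k l, k < l → Disjoint (gridPath B D ⁻¹' exitPaths h x k)
        (gridPath B D ⁻¹' exitPaths h x l) := fun k l hkl => by
      refine Set.disjoint_left.2 fun ω hk hl => hk.1.2 fun j hj => hl.1.1 j (by omega)
    intro k l hkl
    rcases lt_or_gt_of_ne hkl with h' | h'
    · exact this k l h'
    · exact (this l k h').symm
  rw [Set.preimage_iUnion, measure_iUnion hdisj hm]
  -- The overshoot is at most `h`, so the exponential at the exit lies between `1` and `exp(θ h)`.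
  have hlevel : ∀ᵐ ω ∂P, ∀ k, gridPath B D ω ∈ exitPaths h x k →
      gridLevel h (k + 1) (gridPath B D ω) ≤ 0 ∧ -h ≤ gridLevel h (k + 1) (gridPath B D ω) := by
    filter_upwards [H.pos_jump] with ω hω k hk
    have h1 : 0 < gridLevel h k (gridPath B D ω) := hk.1.1 k le_rfl
    have h2 := gridLevel_succ_ge (h := h) (k := k) (p := gridPath B D ω) hω
    refine ⟨?_, by linarith⟩
    by_contra! hc
    refine hk.1.2 fun j hj => ?_
    rcases Nat.le_succ_iff.1 hj with h' | h'
    · exact hk.1.1 j h'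
    · exact h' ▸ hc
  have hlow : ∀ k, P (gridPath B D ⁻¹' exitPaths h x k) ≤ ∫⁻ ω, (exitPaths h x k).indicator
      (fun p => ENNReal.ofReal (Real.exp (-θ * gridLevel h (k + 1) p))) (gridPath B D ω) ∂P := by
    intro k
    rw [← lintegral_indicator_one (hm k)]
    refine lintegral_mono_ae ?_
    filter_upwards [hlevel] with ω hω
    by_cases hk : gridPath B D ω ∈ exitPaths h x k
    · simp only [Set.indicator, Set.mem_preimage, hk, if_true, Pi.one_apply]
      rw [ENNReal.one_le_ofReal, Real.one_le_exp_iff]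
      have := mul_nonneg hθ0 (neg_nonneg.2 (hω k hk).1)
      linarith
    · simp [Set.indicator, hk]
  have hup : ∀ k, ∫⁻ ω, (exitPaths h x k).indicator
      (fun p => ENNReal.ofReal (Real.exp (-θ * gridLevel h (k + 1) p))) (gridPath B D ω) ∂P ≤
      ENNReal.ofReal (Real.exp (θ * h)) * P (gridPath B D ⁻¹' exitPaths h x k) := by
    intro k
    rw [← lintegral_indicator_one (hm k), ← lintegral_const_mul _ (measurable_one.indicator (hm k))]
    refine lintegral_mono_ae ?_
    filter_upwards [hlevel] with ω hω
    by_cases hk : gridPath B D ω ∈ exitPaths h x k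
    · simp only [Set.indicator, Set.mem_preimage, hk, if_true, Pi.one_apply, mul_one]
      refine ENNReal.ofReal_le_ofReal (Real.exp_le_exp.2 ?_)
      have := mul_le_mul_of_nonneg_left (hω k hk).2 hθ0
      linarith
    · simp [Set.indicator, hk]
  have heq := fun n => H.lintegral_expWeight_eq (x := x) (h := h) hγ hgγ hθ n
  constructor
  · refine ENNReal.tsum_le_of_sum_range_le fun n => ?_
    rw [heq n]
    exact (Finset.sum_le_sum fun k _ => hlow k).trans le_add_self
  -- While the level is positive the exponential is at most `1`, so the paths that have not exited
  -- contribute no more than the vanishing probability of bounded jumps.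
  · have hbound : ∀ n, ENNReal.ofReal γ ≤ P (gridPath B D ⁻¹' boundedPaths x n) +
        ENNReal.ofReal (Real.exp (θ * h)) * ∑' k, P (gridPath B D ⁻¹' exitPaths h x k) := by
      intro n
      rw [heq n]
      refine add_le_add ?_ ?_
      · rw [← lintegral_indicator_one (H.measurable_gridPath (measurableSet_boundedPaths x n))]
        refine lintegral_mono fun ω => ?_
        by_cases h1 : gridPath B D ω ∈ positivePaths h n
        · by_cases h2 : gridPath B D ω ∈ boundedPaths x n
          · simp only [Set.indicator, Set.mem_preimage, h1, h2, if_true, Pi.one_apply]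
            rw [ENNReal.ofReal_le_one, Real.exp_le_one_iff]
            have := mul_nonneg hθ0 (h1 n le_rfl).le
            linarith
          · simp [Set.indicator, h2]
        · simp [Set.indicator, h1]
      · rw [← ENNReal.tsum_mul_left]
        exact (Finset.sum_le_sum fun k _ => hup k).trans (ENNReal.sum_le_tsum _)
    have hlim := (H.tendsto_measure_boundedPaths hr hx).add_const
      (ENNReal.ofReal (Real.exp (θ * h)) * ∑' k, P (gridPath B D ⁻¹' exitPaths h x k))
    rw [zero_add] at hlim
    exact ge_of_tendsto' hlim hbound

end IsPoissonGrid

end ProbabilityTheory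

/-! ### From the grid to continuous time. -/

namespace ProbabilityTheory

/-- A sequence of independent identically distributed positive jumps and an independent Poisson
process. -/
structure IsMarkedPoisson {Ω : Type*} [MeasurableSpace Ω] (B : ℕ → Ω → ℝ) (N : ℝ≥0 → Ω → ℕ)
    (r : ℝ≥0) (P : Measure Ω) : Prop where
  measurable_jump : ∀ i, Measurable (B i)
  indep_jump : iIndepFun B P
  ident_jump : ∀ i, IdentDistrib (B i) (B 0) P P
  pos_jump : ∀ᵐ ω ∂P, 0 < B 0 ω
  poisson : IsPoissonProcess N r P
  indep : IndepFun (fun ω (i : ℕ) => B i ω) (fun ω (t : ℝ≥0) => N t ω) P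

/-- The increments of `N` over the intervals from `ρ j h` to `ρ (j + 1) h`. -/
def gridIncrement {Ω : Type*} (N : ℝ≥0 → Ω → ℕ) (ρ h : ℝ≥0) (j : ℕ) (ω : Ω) : ℕ :=
  N (ρ * ((j + 1 : ℕ) * h)) ω - N (ρ * (j * h)) ω

theorem count_gridIncrement {Ω : Type*} {N : ℝ≥0 → Ω → ℕ} {ω : Ω}
    (hmono : Monotone fun t => N t ω) (h0 : N 0 ω = 0) (ρ h : ℝ≥0) (k : ℕ) :
    count (fun j => gridIncrement N ρ h j ω) k = N (ρ * (k * h)) ω := by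
  induction k with
  | zero => simp [count, h0]
  | succ k ih =>
    rw [count_succ, ih, gridIncrement]
    have : N (ρ * (k * h)) ω ≤ N (ρ * ((k + 1 : ℕ) * h)) ω :=
      hmono (mul_le_mul_right (mul_le_mul_left (Nat.cast_le.2 k.le_succ) h) ρ)
    omega

theorem compoundPoisson_eq_gridLevel {Ω : Type*} {B : ℕ → Ω → ℝ} {N : ℝ≥0 → Ω → ℕ} {ω : Ω}
    (hmono : Monotone fun t => N t ω) (h0 : N 0 ω = 0) (ρ h : ℝ≥0) (k : ℕ) :
    compoundPoisson B N ρ (k * h) ω = gridLevel h k (gridPath B (gridIncrement N ρ h) ω) := by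
  rw [compoundPoisson, gridLevel, gridPath, count_gridIncrement hmono h0, Finset.range_eq_Ico,
    Finset.sum_eq_sum_Ico_succ_bot (Nat.succ_pos _)]
  push_cast
  rfl

theorem mem_gridEvent_iff_exitPaths {Ω : Type*} {B : ℕ → Ω → ℝ} {N : ℝ≥0 → Ω → ℕ} {ω : Ω}
    (hmono : Monotone fun t => N t ω) (h0 : N 0 ω = 0) (hB : ∀ i, 0 < B i ω) (ρ h : ℝ≥0) (x : ℝ) :
    ω ∈ gridEvent B N ρ h x ↔
      gridPath B (gridIncrement N ρ h) ω ∈ ⋃ k, exitPaths h x k := by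
  have hc : ∀ k, count (gridPath B (gridIncrement N ρ h) ω).2 k = N (ρ * (k * h)) ω :=
    count_gridIncrement hmono h0 ρ h
  simp only [gridEvent, compoundPoisson_eq_gridLevel hmono h0, Set.mem_ofPred_eq, Set.mem_iUnion,
    exitPaths, Set.mem_inter_iff, Set.mem_sdiff, positivePaths, boundedPaths, hc]
  constructor
  · rintro ⟨k, h1, h2, h3⟩
    -- Since `B 0 > 0`, the exit is never at grid point `0`; `exitPaths` with index `k` exits at `k
    -- + 1`.
    obtain _ | k := k
    · have : 0 < gridLevel h 0 (gridPath B (gridIncrement N ρ h) ω) := by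
        simpa [gridLevel, count, gridPath] using hB 0
      exact absurd h2 (not_le.2 this)
    · exact ⟨k, ⟨fun j hj => h1 j (by omega), fun H => absurd (H (k + 1) le_rfl) (not_lt.2 h2)⟩, h3⟩
  · rintro ⟨k, ⟨h1, h2⟩, h3⟩
    refine ⟨k + 1, fun j hj => h1 j (by omega), ?_, h3⟩
    by_contra! hpos
    refine h2 fun j hj => ?_
    rcases Nat.le_succ_iff.1 hj with h' | h'
    · exact h1 j h'
    · exact h' ▸ hpos

namespace IsMarkedPoisson

variable {Ω : Type*} [MeasurableSpace Ω] {P : Measure Ω} {B : ℕ → Ω → ℝ} {N : ℝ≥0 → Ω → ℕ}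
  {r : ℝ≥0}

theorem ae_pos_jump (H : IsMarkedPoisson B N r P) : ∀ᵐ ω ∂P, ∀ i, 0 < B i ω :=
  ae_all_iff.2 fun i => (H.ident_jump i).symm.ae_snd measurableSet_Ioi H.pos_jump

theorem isPoissonGrid (H : IsMarkedPoisson B N r P) (ρ h : ℝ≥0) :
    IsPoissonGrid B (gridIncrement N ρ h) (r * (ρ * h)) P where
  measurable_jump := H.measurable_jump
  measurable_count j := (H.poisson.measurable _).sub (H.poisson.measurable _)
  indep_jump := H.indep_jump
  ident_jump := H.ident_jump
  pos_jump := H.ae_pos_jump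
  indep_count := H.poisson.increments_indep.nat (t := fun j : ℕ => ρ * (j * h))
    fun i j hij => mul_le_mul_right (mul_le_mul_left (Nat.cast_le.2 hij) h) ρ
  law_count j := by
    have hle : ρ * (j * h) ≤ ρ * ((j + 1 : ℕ) * h) :=
      mul_le_mul_right (mul_le_mul_left (Nat.cast_le.2 j.le_succ) h) ρ
    have he : ρ * ((j + 1 : ℕ) * h) - ρ * (j * h) = ρ * h := by
      rw [tsub_eq_iff_eq_add_of_le hle]
      push_cast
      ring
    have := H.poisson.increments_law _ _ hle
    rwa [he] at this
  indep := H.indep.comp (φ := id)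
    (ψ := fun n : ℝ≥0 → ℕ => fun j : ℕ => n (ρ * ((j + 1 : ℕ) * h)) - n (ρ * (j * h)))
    measurable_id (measurable_pi_lambda _ fun _ => (measurable_pi_apply _).sub
      (measurable_pi_apply _))

variable [IsProbabilityMeasure P]

/-- Almost surely, zero is hit or there are arbitrarily large jumps. -/
theorem ae_not_forall_le (H : IsMarkedPoisson B N r P) (hr : 0 < r) {ρ : ℝ≥0} (hρ : 0 < ρ) {x : ℝ}
    (hx : P {ω | B 0 ω ≤ x} < 1) :
    ∀ᵐ ω ∂P, ¬ ∀ t i, i ≤ N (ρ * t) ω → B i ω ≤ x := by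
  have hlim := (H.isPoissonGrid ρ 1).tendsto_measure_boundedPaths (by positivity) hx
  have hz : P (⋂ k, gridPath B (gridIncrement N ρ 1) ⁻¹' boundedPaths x k) = 0 :=
    le_antisymm (ge_of_tendsto' hlim fun k => measure_mono (Set.iInter_subset _ k)) zero_le
  filter_upwards [compl_mem_ae_iff.2 hz, H.poisson.monotone, H.poisson.start_zero]
    with ω hω hmono h0 hall
  refine hω (Set.mem_iInter.2 fun k i hi => hall (k * 1) i ?_)
  rwa [← count_gridIncrement hmono h0]

/-- The distribution function of the largest jump solves a fixed point equation. -/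
theorem measure_largestJump_le (H : IsMarkedPoisson B N r P) (hr : 0 < r) {ρ : ℝ≥0} (hρ : 0 < ρ)
    {x γ : ℝ} (hx : P {ω | B 0 ω ≤ x} < 1) (hγ : 0 ≤ γ) (hγ1 : γ ≤ 1)
    (hfix : ∫⁻ ω, expWeight (r * ρ * (1 - γ)) x (B 0 ω) ∂P = ENNReal.ofReal γ) :
    NullMeasurableSet {ω | largestJump B N ρ ω ≤ x} P ∧
      P {ω | largestJump B N ρ ω ≤ x} = ENNReal.ofReal γ := by
  set θ : ℝ := r * ρ * (1 - γ) with hθ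
  have hθ0 : 0 ≤ θ := mul_nonneg (by positivity) (by linarith)
  let h : ℕ → ℝ≥0 := fun n => 1 / ((n : ℝ≥0) + 1)
  have hpos : ∀ n, 0 < h n := fun n => by positivity
  have hlim : Tendsto h atTop (𝓝 0) := tendsto_one_div_add_atTop_nhds_zero_nat
  let A : ℕ → Set Ω := fun n =>
    gridPath B (gridIncrement N ρ (h n)) ⁻¹' ⋃ k, exitPaths (h n) x k
  have hA : ∀ n, MeasurableSet (A n) := fun n => (H.isPoissonGrid ρ (h n)).measurable_gridPath
    (MeasurableSet.iUnion fun k => measurableSet_exitPaths _ _ _)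
  have hAP : ∀ n, P (A n) ≤ ENNReal.ofReal γ ∧
      ENNReal.ofReal γ ≤ ENNReal.ofReal (Real.exp (θ * h n)) * P (A n) := fun n =>
    (H.isPoissonGrid ρ (h n)).measure_iUnion_exitPaths
      (mul_pos hr (mul_pos hρ (hpos n))) hγ hfix (by push_cast; ring) hθ0 hx
  -- If zero is hit, it suffices that the mesh is below the jump-free gap after `s`. Otherwise both
  -- sides fail, as almost surely some jump exceeds `x`.
  have hae : ∀ᵐ ω ∂P, ∀ᶠ n in atTop, ω ∈ A n ↔ ω ∈ {ω | largestJump B N ρ ω ≤ x} := by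
    filter_upwards [H.poisson.monotone, H.poisson.start_zero, H.poisson.right_continuous,
      H.ae_pos_jump, H.ae_not_forall_le hr hρ hx] with ω hmono h0 hrc hB hnot
    have hgrid : ∀ n, ω ∈ A n ↔ ω ∈ gridEvent B N ρ (h n) x := fun n =>
      (mem_gridEvent_iff_exitPaths hmono h0 hB ρ (h n) x).symm
    simp only [hgrid]
    by_cases hX : ∃ t, compoundPoisson B N ρ t ω ≤ 0
    · obtain ⟨s, hs, hsp, hτ, u, hsu, hu⟩ := exists_hitZero_eq hmono h0 hrc hB hX
      have : ∀ᶠ n in atTop, h n < u - s := hlim.eventually_lt_const (tsub_pos_of_lt hsu)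
      filter_upwards [this] with n hn
      refine mem_gridEvent_iff hmono hs hsp hτ hu (hpos n) ?_
      rw [add_comm]
      exact (add_le_add_left hn.le s).trans (tsub_add_cancel_of_le hsu.le).le
    · refine Eventually.of_forall fun n => iff_of_false ?_ ?_
      · rintro ⟨k, -, hk, -⟩
        exact hX ⟨_, hk⟩
      · exact fun hle => hnot fun t i hi => le_of_largestJump_le (hitZero_eq_top hX) hle hi
  have hnull := nullMeasurableSet_of_tendsto_indicator atTop
    (fun n => (hA n).nullMeasurableSet) hae
  refine ⟨hnull, ?_⟩
  -- The event is only known to be null measurable, so a measurable version serves as the limit set.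
  obtain ⟨A', -, hA'm, hA'⟩ := hnull.exists_measurable_superset_ae_eq
  have hlimP : Tendsto (fun n => P (A n)) atTop (𝓝 (P A')) := by
    refine tendsto_measure_of_ae_tendsto_indicator_of_isFiniteMeasure atTop hA'm hA ?_
    filter_upwards [hae, hA'.mem_iff] with ω h1 h2
    filter_upwards [h1] with n hn
    exact hn.trans h2.symm
  rw [← measure_congr hA']
  have hexp : Tendsto (fun n => ENNReal.ofReal (Real.exp (θ * h n))) atTop (𝓝 1) := by
    have h1 : Tendsto (fun n => ((h n : ℝ≥0) : ℝ)) atTop (𝓝 0) :=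
      (NNReal.tendsto_coe.2 hlim)
    have h2 := ENNReal.tendsto_ofReal ((Real.continuous_exp.tendsto _).comp (h1.const_mul θ))
    simpa using h2
  refine le_antisymm (le_of_tendsto' hlimP fun n => (hAP n).1) ?_
  have h3 := ENNReal.Tendsto.mul hexp (Or.inl one_ne_zero) hlimP (Or.inr ENNReal.one_ne_top)
  rw [one_mul] at h3
  exact ge_of_tendsto' h3 fun n => (hAP n).2

end IsMarkedPoisson

end ProbabilityTheory

/-! ### Consequences of the regularly varying tail. -/

section Moments

variable {Ω : Type*} [MeasurableSpace Ω] {P : Measure Ω} {X : Ω → ℝ}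

theorem tendsto_tail_two_mul_div {L : ℝ → ℝ} (hL : SlowlyVarying L) {α : ℝ}
    (htail : ∀ x, 0 < x → P.real {ω | x < X ω} = L x * x ^ (-α)) :
    Tendsto (fun x => P.real {ω | 2 * x < X ω} / P.real {ω | x < X ω}) atTop
      (𝓝 ((2 : ℝ) ^ (-α))) := by
  have h := (hL 2 two_pos).mul_const ((2 : ℝ) ^ (-α))
  rw [one_mul] at h
  refine h.congr' ?_
  filter_upwards [eventually_gt_atTop 0] with x hx
  rw [htail x hx, htail (2 * x) (by positivity), Real.mul_rpow two_pos.le hx.le]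
  have : x ^ (-α) ≠ 0 := (Real.rpow_pos_of_pos hx _).ne'
  field_simp

variable [IsProbabilityMeasure P]

theorem measureReal_gt_antitone : Antitone fun x => P.real {ω | x < X ω} :=
  fun _ _ hxy => measureReal_mono fun _ hω => lt_of_le_of_lt hxy hω

/-- If the tail vanished somewhere, `L` would eventually be zero, and `L y / L y` would be `0` by
the convention for division by zero instead of tending to `1`. -/
theorem tail_pos {L : ℝ → ℝ} (hL : SlowlyVarying L) {α : ℝ}
    (htail : ∀ x, 0 < x → P.real {ω | x < X ω} = L x * x ^ (-α)) (x : ℝ) :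
    0 < P.real {ω | x < X ω} := by
  by_contra! h
  have h0 : P.real {ω | x < X ω} = 0 := le_antisymm h measureReal_nonneg
  have hLz : ∀ᶠ y in atTop, L (1 * y) / L y = 0 := by
    filter_upwards [eventually_gt_atTop (max x 0)] with y hy
    have hy0 : 0 < y := (le_max_right _ _).trans_lt hy
    have h1 : P.real {ω | y < X ω} = 0 := le_antisymm
      ((measureReal_gt_antitone ((le_max_left x 0).trans hy.le)).trans h0.le) measureReal_nonneg
    rw [htail y hy0] at h1
    have : L y = 0 := (mul_eq_zero.1 h1).resolve_right (Real.rpow_pos_of_pos hy0 _).ne'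
    simp [this]
  have := tendsto_nhds_unique ((hL 1 one_pos).congr' hLz) tendsto_const_nhds
  exact one_ne_zero this

/-- A positive random variable whose tail is regularly varying of index less than `-2` has a finite
second moment. -/
theorem memLp_two_of_slowlyVarying (hX : Measurable X) (hpos : ∀ᵐ ω ∂P, 0 < X ω) {L : ℝ → ℝ}
    (hL : SlowlyVarying L) {α : ℝ} (hα : 2 < α)
    (htail : ∀ x, 0 < x → P.real {ω | x < X ω} = L x * x ^ (-α)) : MemLp X 2 P := by
  -- Doubling the level multiplies the tail by less than `1 / 4` in the limit, which beats the
  -- factor `4` gained by the square on dyadic shells.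
  have hlt : (2 : ℝ) ^ (-α) < 1 / 4 := by
    have := Real.rpow_lt_rpow_of_exponent_lt (x := 2) one_lt_two (neg_lt_neg hα)
    have h4 : (2 : ℝ) ^ (-2 : ℝ) = 1 / 4 := by
      rw [Real.rpow_neg two_pos.le]; norm_num
    rwa [h4] at this
  obtain ⟨c, hc1, hc2⟩ := exists_between hlt
  have hc0 : 0 < c := (Real.rpow_pos_of_pos two_pos _).trans hc1
  obtain ⟨y, hy⟩ := eventually_atTop.1 (((tendsto_tail_two_mul_div hL htail).eventually_lt_const
    hc1).and (eventually_gt_atTop 0))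
  have hy0 : 0 < y := (hy y le_rfl).2
  have hgeom : ∀ n : ℕ, P.real {ω | 2 ^ n * y < X ω} ≤ c ^ n := fun n => by
    induction n with
    | zero => simp
    | succ n ih =>
      have h1 := (hy (2 ^ n * y) (le_mul_of_one_le_left hy0.le (one_le_pow₀ one_le_two))).1
      rw [div_lt_iff₀ (tail_pos hL htail _)] at h1
      have he : (2 : ℝ) ^ (n + 1) * y = 2 * (2 ^ n * y) := by ring
      rw [he, pow_succ']
      exact h1.le.trans (mul_le_mul_of_nonneg_left ih hc0.le)
  have hm : ∀ n : ℕ, MeasurableSet {ω | 2 ^ n * y < X ω} := fun n =>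
    measurableSet_lt measurable_const hX
  rw [memLp_two_iff_integrable_sq hX.aestronglyMeasurable]
  refine ⟨(hX.pow_const 2).aestronglyMeasurable, ?_⟩
  rw [hasFiniteIntegral_iff_ofReal (Eventually.of_forall fun ω => sq_nonneg _)]
  -- The single term of the dyadic shell containing `X ω` suffices; shells start at `2 * y` so that
  -- `2 ^ n * y < X ω` is strict.
  have hptw : ∀ᵐ ω ∂P, ENNReal.ofReal (X ω ^ 2) ≤ ENNReal.ofReal ((2 * y) ^ 2) +
      ∑' n : ℕ, ENNReal.ofReal ((2 ^ (n + 1) * (2 * y)) ^ 2) *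
        {ω | 2 ^ n * y < X ω}.indicator 1 ω := by
    filter_upwards [hpos] with ω hω
    rcases le_or_gt (X ω) (2 * y) with h | h
    · exact le_add_right (ENNReal.ofReal_le_ofReal (pow_le_pow_left₀ hω.le h 2))
    · have h2y : 0 < 2 * y := by positivity
      obtain ⟨n, hn1, hn2⟩ := exists_nat_pow_near (one_le_div h2y |>.2 h.le) one_lt_two
      rw [le_div_iff₀ h2y] at hn1
      rw [div_lt_iff₀ h2y] at hn2
      refine le_add_left (le_trans ?_ (ENNReal.le_tsum n))
      have hmem : ω ∈ {ω | 2 ^ n * y < X ω} := by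
        have : 0 < (2 : ℝ) ^ n * y := by positivity
        show 2 ^ n * y < X ω
        linarith
      rw [Set.indicator_of_mem hmem, Pi.one_apply, mul_one]
      exact ENNReal.ofReal_le_ofReal (pow_le_pow_left₀ hω.le hn2.le 2)
  refine lt_of_le_of_lt (lintegral_mono_ae hptw) ?_
  rw [lintegral_add_left measurable_const, lintegral_const, measure_univ, mul_one,
    lintegral_tsum fun n => ((measurable_one.indicator (hm n)).const_mul _).aemeasurable]
  refine ENNReal.add_lt_top.2 ⟨ENNReal.ofReal_lt_top, ?_⟩
  have hterm : ∀ n : ℕ, ∫⁻ ω, ENNReal.ofReal ((2 ^ (n + 1) * (2 * y)) ^ 2) *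
      {ω | 2 ^ n * y < X ω}.indicator 1 ω ∂P ≤
      ENNReal.ofReal (16 * y ^ 2) * ENNReal.ofReal (4 * c) ^ n := fun n => by
    rw [lintegral_const_mul _ (measurable_one.indicator (hm n)), lintegral_indicator_one (hm n),
      ← ofReal_measureReal, ← ENNReal.ofReal_mul (by positivity),
      ← ENNReal.ofReal_pow (by positivity), ← ENNReal.ofReal_mul (by positivity)]
    refine ENNReal.ofReal_le_ofReal ?_
    calc _ ≤ (2 ^ (n + 1) * (2 * y)) ^ 2 * c ^ n :=
          mul_le_mul_of_nonneg_left (hgeom n) (by positivity)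
      _ = 16 * y ^ 2 * (((2 : ℝ) ^ n) ^ 2 * c ^ n) := by ring
      _ = _ := by
        rw [mul_pow 4 c, ← pow_mul, mul_comm n 2, pow_mul]; norm_num
  refine (ENNReal.tsum_le_tsum hterm).trans_lt ?_
  rw [ENNReal.tsum_mul_left, ENNReal.tsum_geometric]
  refine ENNReal.mul_lt_top ENNReal.ofReal_lt_top (ENNReal.inv_lt_top.2 (tsub_pos_of_lt ?_))
  rw [ENNReal.ofReal_lt_one]
  linarith

/-- Markov's inequality on `{X > x}` bounds the product by `E[X²; X > x]`, which vanishes by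
dominated convergence. -/
theorem tendsto_sq_mul_tail (hX : Measurable X) (hX2 : MemLp X 2 P) :
    Tendsto (fun x : ℝ => x ^ 2 * P.real {ω | x < X ω}) atTop (𝓝 0) := by
  have hm : ∀ x : ℝ, MeasurableSet {ω | x < X ω} := fun x => measurableSet_lt measurable_const hX
  have hint := hX2.integrable_sq
  have hlim : Tendsto (fun x : ℝ => ∫ ω, {ω | x < X ω}.indicator (fun ω => X ω ^ 2) ω ∂P) atTop
      (𝓝 (∫ _, (0 : ℝ) ∂P)) := by
    refine tendsto_integral_filter_of_dominated_convergence (fun ω => X ω ^ 2)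
      (Eventually.of_forall fun x => ((hX.pow_const 2).indicator (hm x)).aestronglyMeasurable)
      (Eventually.of_forall fun x => Eventually.of_forall fun ω => ?_) hint
      (Eventually.of_forall fun ω => ?_)
    · rw [Real.norm_of_nonneg (Set.indicator_nonneg (fun _ _ => sq_nonneg _) _)]
      exact Set.indicator_le_self' (fun _ _ => sq_nonneg _) _
    · refine tendsto_const_nhds.congr' ?_
      filter_upwards [eventually_ge_atTop (X ω)] with x hx
      exact (Set.indicator_of_notMem (s := {ω | x < X ω}) (not_lt.2 hx) _).symm
  rw [integral_zero] at hlim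
  refine tendsto_of_tendsto_of_tendsto_of_le_of_le' tendsto_const_nhds hlim
    (Eventually.of_forall fun x => mul_nonneg (sq_nonneg _) measureReal_nonneg) ?_
  filter_upwards [eventually_ge_atTop 0] with x hx
  have h1 : ∫ ω, {ω | x < X ω}.indicator (fun _ => x ^ 2) ω ∂P = x ^ 2 * P.real {ω | x < X ω} := by
    rw [integral_indicator_const _ (hm x), smul_eq_mul, mul_comm]
  rw [← h1]
  refine integral_mono ((integrable_const _).indicator (hm x)) (hint.indicator (hm x)) fun ω => ?_
  exact Set.indicator_le_indicator' fun hω => pow_le_pow_left₀ hx (le_of_lt hω) 2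

end Moments

/-! ### The fixed point equation: existence and quantitative bounds. -/

section FixedPoint

variable {Ω : Type*} [MeasurableSpace Ω] {P : Measure Ω} [IsProbabilityMeasure P] {X : Ω → ℝ}

theorem integrable_indicator_exp (hX : Measurable X) (hpos : ∀ᵐ ω ∂P, 0 < X ω) (x : ℝ) {c : ℝ}
    (hc : 0 ≤ c) :
    Integrable ({ω | X ω ≤ x}.indicator fun ω => Real.exp (-c * X ω)) P := by
  have hm : MeasurableSet {ω | X ω ≤ x} := measurableSet_le hX measurable_const
  refine Integrable.indicator ?_ hm
  refine Integrable.of_bound (by fun_prop) 1 ?_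
  filter_upwards [hpos] with ω hω
  rw [Real.norm_of_nonneg (Real.exp_pos _).le, Real.exp_le_one_iff]
  nlinarith

theorem exists_fixedPoint (hX : Measurable X) (hpos : ∀ᵐ ω ∂P, 0 < X ω) (x : ℝ) {c : ℝ}
    (hc : 0 ≤ c) :
    ∃ q ∈ Set.Icc (0 : ℝ) 1,
      1 - q = ∫ ω, {ω | X ω ≤ x}.indicator (fun ω => Real.exp (-(c * q) * X ω)) ω ∂P := by
  have hm : MeasurableSet {ω | X ω ≤ x} := measurableSet_le hX measurable_const
  set f : ℝ → ℝ := fun q =>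
    q - 1 + ∫ ω, {ω | X ω ≤ x}.indicator (fun ω => Real.exp (-(c * q) * X ω)) ω ∂P with hf
  have hcont : ContinuousOn f (Set.Icc 0 1) := by
    refine (continuousOn_id.sub continuousOn_const).add ?_
    refine continuousOn_of_dominated (bound := fun _ => 1) (fun q hq => ?_) (fun q hq => ?_)
      (integrable_const 1) (Eventually.of_forall fun ω => ?_)
    · exact (integrable_indicator_exp hX hpos x (mul_nonneg hc hq.1)).aestronglyMeasurable
    · filter_upwards [hpos] with ω hω
      rw [Real.norm_of_nonneg (Set.indicator_nonneg (fun _ _ => (Real.exp_pos _).le) _)]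
      refine Set.indicator_apply_le' (fun _ => ?_) (fun _ => zero_le_one)
      rw [Real.exp_le_one_iff]
      have := mul_nonneg (mul_nonneg hc hq.1) hω.le
      linarith
    · by_cases h : X ω ≤ x
      · simp only [Set.indicator, Set.mem_ofPred_eq, h, if_true]
        fun_prop
      · simp only [Set.indicator, Set.mem_ofPred_eq, h, if_false]
        fun_prop
  have h0 : f 0 ≤ 0 := by
    have : ∫ ω, {ω | X ω ≤ x}.indicator (fun ω => Real.exp (-(c * 0) * X ω)) ω ∂P =
        P.real {ω | X ω ≤ x} := by
      simp only [mul_zero, neg_zero, zero_mul, Real.exp_zero]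
      exact integral_indicator_one hm
    simp only [hf, this]
    linarith [measureReal_le_one (μ := P) (s := {ω | X ω ≤ x})]
  have h1 : 0 ≤ f 1 := by
    simp only [hf, sub_self, zero_add]
    exact integral_nonneg fun ω => Set.indicator_nonneg (fun _ _ => (Real.exp_pos _).le) _
  obtain ⟨q, hq, hfq⟩ := intermediate_value_Icc zero_le_one hcont ⟨h0, h1⟩
  exact ⟨q, hq, by simp only [hf] at hfq; linarith⟩

/-- `(1 - y + y²/2)(1 + y + y²/2) = 1 + y⁴/4 ≥ 1`. -/
theorem exp_neg_le_quadratic {y : ℝ} (hy : 0 ≤ y) : Real.exp (-y) ≤ 1 - y + y ^ 2 / 2 := by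
  have h := Real.quadratic_le_exp_of_nonneg hy
  rw [Real.exp_neg, inv_le_iff_one_le_mul₀ (Real.exp_pos y)]
  have h1 : 0 ≤ 1 - y + y ^ 2 / 2 := by nlinarith [sq_nonneg (y - 1)]
  have h2 := mul_le_mul_of_nonneg_left h h1
  nlinarith [sq_nonneg (y ^ 2)]

theorem integral_quadratic_add_indicator (hX2 : MemLp X 2 P) {S : Set Ω} (hS : MeasurableSet S)
    (a₀ a₁ a₂ a₃ : ℝ) :
    Integrable (fun ω => a₀ + a₁ * S.indicator (fun _ => (1 : ℝ)) ω + a₂ * X ω + a₃ * X ω ^ 2) P ∧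
    ∫ ω, (a₀ + a₁ * S.indicator (fun _ => (1 : ℝ)) ω + a₂ * X ω + a₃ * X ω ^ 2) ∂P =
      a₀ + a₁ * P.real S + a₂ * ∫ ω, X ω ∂P + a₃ * ∫ ω, X ω ^ 2 ∂P := by
  have i0 : Integrable (fun _ : Ω => a₀) P := integrable_const a₀
  have i1 : Integrable (fun ω => a₁ * S.indicator (fun _ => (1 : ℝ)) ω) P :=
    ((integrable_const 1).indicator hS).const_mul _
  have i2 : Integrable (fun ω => a₂ * X ω) P := (hX2.integrable one_le_two).const_mul _
  have i3 : Integrable (fun ω => a₃ * X ω ^ 2) P := hX2.integrable_sq.const_mul _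
  have i01 : Integrable (fun ω => a₀ + a₁ * S.indicator (fun _ => (1 : ℝ)) ω) P := i0.add i1
  have i012 : Integrable (fun ω => a₀ + a₁ * S.indicator (fun _ => (1 : ℝ)) ω + a₂ * X ω) P :=
    i01.add i2
  have hS1 : ∫ ω, S.indicator (fun _ => (1 : ℝ)) ω ∂P = P.real S := integral_indicator_one hS
  refine ⟨i012.add i3, ?_⟩
  rw [integral_add i012 i3, integral_add i01 i2, integral_add i0 i1, integral_const_mul,
    integral_const_mul, integral_const_mul, hS1, integral_const, probReal_univ, one_smul]

/-- Bounds for the solution of the fixed point equation. -/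
theorem fixedPoint_bounds (hX : Measurable X) (hpos : ∀ᵐ ω ∂P, 0 < X ω) (hX2 : MemLp X 2 P)
    {x c q : ℝ} (hc : 0 ≤ c) (hq : 0 ≤ q) (hG : 0 < P.real {ω | x < X ω})
    (hfix : 1 - q = ∫ ω, {ω | X ω ≤ x}.indicator (fun ω => Real.exp (-(c * q) * X ω)) ω ∂P) :
    q - c * q * ∫ ω, X ω ∂P ≤ P.real {ω | x < X ω} ∧
      P.real {ω | x < X ω} ≤ q - c * q * ∫ ω, X ω ∂P +
        c * q * (((∫ ω, X ω ^ 2 ∂P) + 1) / 2 * √(P.real {ω | x < X ω})) +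
        (c * q) ^ 2 / 2 * ∫ ω, X ω ^ 2 ∂P := by
  set G := P.real {ω | x < X ω} with hGdef
  have hm : MeasurableSet {ω | x < X ω} := measurableSet_lt measurable_const hX
  have hcq : 0 ≤ c * q := mul_nonneg hc hq
  have hexp := integrable_indicator_exp hX hpos x hcq
  have hsG : 0 < √G := Real.sqrt_pos.2 hG
  have hsG2 : √G * √G = G := Real.mul_self_sqrt hG.le
  constructor
  · obtain ⟨hi, he⟩ := integral_quadratic_add_indicator hX2 hm 1 (-1) (-(c * q)) 0
    have hle := integral_mono_ae hi hexp (by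
      filter_upwards [hpos] with ω hω
      have h1 := Real.add_one_le_exp (-(c * q) * X ω)
      have h2 : 0 ≤ c * q * X ω := by positivity
      by_cases h : X ω ≤ x
      · simp only [Set.indicator, Set.mem_ofPred_eq, h, not_lt.2 h, if_true, if_false]
        linarith
      · simp only [Set.indicator, Set.mem_ofPred_eq, h, not_le.1 h, if_true, if_false]
        linarith)
    rw [he, ← hfix] at hle
    linarith
  -- On `{X > x}` the linear term is absorbed by `X ≤ (1/√G + √G X²)/2`, a completed square; the
  -- weight `√G` makes both parts of order `√G` after integration.
  · obtain ⟨hi, he⟩ := integral_quadratic_add_indicator hX2 hm 1 (-1 + c * q / (2 * √G)) (-(c * q))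
      (c * q * √G / 2 + (c * q) ^ 2 / 2)
    have hle := integral_mono_ae hexp hi (by
      filter_upwards [hpos] with ω hω
      have h2 : 0 ≤ c * q * X ω := by positivity
      by_cases h : X ω ≤ x
      · simp only [Set.indicator, Set.mem_ofPred_eq, h, not_lt.2 h, if_true, if_false]
        have h1 := exp_neg_le_quadratic h2
        have h3 : 0 ≤ c * q * √G / 2 * X ω ^ 2 := by positivity
        rw [neg_mul]
        linarith
      · simp only [Set.indicator, Set.mem_ofPred_eq, h, not_le.1 h, if_true, if_false]
        have h3 : c * q / (2 * √G) - c * q * X ω + c * q * √G / 2 * X ω ^ 2 =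
            c * q * ((√G * X ω - 1) ^ 2 / (2 * √G)) := by
          field_simp; ring
        have h4 : 0 ≤ c * q * ((√G * X ω - 1) ^ 2 / (2 * √G)) := by positivity
        have h6 : 0 ≤ (c * q) ^ 2 / 2 * X ω ^ 2 := by positivity
        linarith)
    rw [he, ← hfix] at hle
    have hs : c * q / (2 * √G) * G = c * q * √G / 2 := by
      nth_rewrite 2 [← hsG2]; field_simp
    rw [← hGdef, add_mul, hs] at hle
    linarith

end FixedPoint

/-- The bound `q ≤ G / δ` is inserted into the error terms of `hlow`; relative to `G` they become
multiples of `√G / δ` and `G / δ²`. -/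
theorem abs_div_sub_one_le {q G δ c r K s E : ℝ} (hG : 0 < G) (hδ : 0 < δ) (hq : 0 ≤ q)
    (hc : 0 ≤ c) (hcr : c ≤ r) (hK : 0 ≤ K) (hs : 0 ≤ s) (hup : q * δ ≤ G)
    (hlow : G ≤ q * δ + c * q * (K * √G) + (c * q) ^ 2 / 2 * s) (hE : G / δ ^ 2 ≤ E) :
    |q / (1 / δ * G) - 1| ≤ r * K * √E + r ^ 2 / 2 * s * E := by
  have hr : 0 ≤ r := hc.trans hcr
  have hqd : q / (1 / δ * G) = q * δ / G := by field_simp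
  have hqG : q ≤ G / δ := (le_div_iff₀ hδ).2 hup
  have hsq : √G / δ = √(G / δ ^ 2) := by
    rw [Real.sqrt_div hG.le, Real.sqrt_sq hδ.le]
  have hsE : √G / δ ≤ √E := hsq ▸ Real.sqrt_le_sqrt hE
  have hle1 : q * δ / G ≤ 1 := (div_le_one hG).2 hup
  rw [hqd, abs_sub_comm, abs_of_nonneg (by linarith)]
  have hcq : c * q ≤ r * (G / δ) := mul_le_mul hcr hqG hq hr
  have hcq0 : 0 ≤ c * q := mul_nonneg hc hq
  have h1 : 1 - q * δ / G ≤ (r * (G / δ) * (K * √G) + (r * (G / δ)) ^ 2 / 2 * s) / G := by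
    rw [le_div_iff₀ hG, sub_mul, div_mul_cancel₀ _ hG.ne', one_mul]
    have h2 : c * q * (K * √G) ≤ r * (G / δ) * (K * √G) :=
      mul_le_mul_of_nonneg_right hcq (by positivity)
    have h3 : (c * q) ^ 2 / 2 * s ≤ (r * (G / δ)) ^ 2 / 2 * s := by gcongr
    linarith
  have h4 : (r * (G / δ) * (K * √G) + (r * (G / δ)) ^ 2 / 2 * s) / G =
      r * K * (√G / δ) + r ^ 2 / 2 * s * (G / δ ^ 2) := by
    field_simp
  rw [h4] at h1
  refine h1.trans ?_
  gcongr

/-! ### Uniform asymptotics of the largest jump. -/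

namespace ProbabilityTheory.IsMarkedPoisson

variable {Ω : Type*} [MeasurableSpace Ω] {P : Measure Ω} {B : ℕ → Ω → ℝ} {N : ℝ≥0 → Ω → ℕ}
  {r : ℝ≥0} [IsProbabilityMeasure P]

/-- The tail probability of the largest jump solves a fixed point equation. -/
theorem one_sub_measureReal_largestJump (H : IsMarkedPoisson B N r P) (hr : 0 < r) {ρ : ℝ≥0}
    (hρ : 0 < ρ) {x : ℝ} (hx : 0 < P.real {ω | x < B 0 ω}) :
    1 - P.real {ω | (x : EReal) < largestJump B N ρ ω} =
      ∫ ω, {ω | B 0 ω ≤ x}.indicator (fun ω => Real.exp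
        (-(r * ρ * P.real {ω | (x : EReal) < largestJump B N ρ ω}) * B 0 ω)) ω ∂P := by
  have hX := H.measurable_jump 0
  have hc : (0 : ℝ) ≤ r * ρ := by positivity
  have hm : MeasurableSet {ω | B 0 ω ≤ x} := measurableSet_le hX measurable_const
  have hx1 : P {ω | B 0 ω ≤ x} < 1 := by
    refine lt_of_le_of_ne prob_le_one fun h1 => ?_
    have h2 : P {ω | x < B 0 ω} = 0 := by
      have := (prob_compl_eq_zero_iff hm).2 h1
      rwa [show {ω | B 0 ω ≤ x}ᶜ = {ω | x < B 0 ω} by ext; simp] at this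
    simp [measureReal_def, h2] at hx
  -- Uniqueness is not needed: `measure_largestJump_le` identifies any solution in `[0, 1]` with the
  -- probability.
  obtain ⟨q, ⟨hq0, hq1⟩, hq⟩ := exists_fixedPoint hX H.pos_jump x hc
  have hfix : ∫⁻ ω, expWeight (r * ρ * (1 - (1 - q))) x (B 0 ω) ∂P = ENNReal.ofReal (1 - q) := by
    rw [hq, ofReal_integral_eq_lintegral_ofReal
      (integrable_indicator_exp hX H.pos_jump x (mul_nonneg hc hq0))
      (Eventually.of_forall fun ω => Set.indicator_nonneg (fun _ _ => (Real.exp_pos _).le) _)]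
    refine lintegral_congr fun ω => ?_
    rw [← hq]
    by_cases h : B 0 ω ≤ x <;> simp [expWeight, h]
  obtain ⟨hnull, hP⟩ := H.measure_largestJump_le hr hρ hx1 (by linarith) (by linarith) hfix
  have hreal : P.real {ω | largestJump B N ρ ω ≤ x} = 1 - q := by
    rw [measureReal_def, hP, ENNReal.toReal_ofReal (by linarith)]
  have hcompl : {ω | (x : EReal) < largestJump B N ρ ω} = {ω | largestJump B N ρ ω ≤ x}ᶜ := by
    ext; simp
  have hqP : P.real {ω | (x : EReal) < largestJump B N ρ ω} = q := by
    rw [hcompl, probReal_compl_eq_one_sub₀ hnull, hreal, sub_sub_cancel]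
  rw [hqP, hq]

/-- The relative error of the approximation of the tail probability of the largest jump. -/
theorem abs_measureReal_largestJump_div_sub_one_le (H : IsMarkedPoisson B N r P)
    (hB2 : MemLp (B 0) 2 P) (hr : (r : ℝ) * ∫ ω, B 0 ω ∂P = 1) {ρ : ℝ≥0} (hρ : 0 < ρ) (hρ1 : ρ < 1)
    {x E : ℝ} (hx : 0 < P.real {ω | x < B 0 ω})
    (hE : P.real {ω | x < B 0 ω} / (1 - (ρ : ℝ)) ^ 2 ≤ E) :
    |P.real {ω | (x : EReal) < largestJump B N ρ ω} /
        (1 / (1 - (ρ : ℝ)) * P.real {ω | x < B 0 ω}) - 1| ≤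
      r * (((∫ ω, B 0 ω ^ 2 ∂P) + 1) / 2) * √E + (r : ℝ) ^ 2 / 2 * (∫ ω, B 0 ω ^ 2 ∂P) * E := by
  have hr0 : 0 < r := by
    refine pos_iff_ne_zero.2 fun h => ?_
    simp [h] at hr
  have hρ1' : (ρ : ℝ) < 1 := by exact_mod_cast hρ1
  have hs : 0 ≤ ∫ ω, B 0 ω ^ 2 ∂P := integral_nonneg fun ω => sq_nonneg _
  have hfix := H.one_sub_measureReal_largestJump hr0 hρ hx
  set q := P.real {ω | (x : EReal) < largestJump B N ρ ω}
  obtain ⟨h1, h2⟩ := fixedPoint_bounds (H.measurable_jump 0) H.pos_jump hB2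
    (by positivity : (0 : ℝ) ≤ r * ρ) (measureReal_nonneg : 0 ≤ q) hx hfix
  -- The normalization `r E[B] = 1` turns the linear part of the bounds into `q (1 - ρ)`.
  have hcm : (r : ℝ) * ρ * q * ∫ ω, B 0 ω ∂P = ρ * q := by
    linear_combination (ρ * q : ℝ) * hr
  rw [hcm] at h1 h2
  refine abs_div_sub_one_le hx (by linarith) measureReal_nonneg (by positivity)
    (mul_le_of_le_one_right r.coe_nonneg hρ1'.le) (by positivity) hs (by linarith) (by linarith) hE

/-- The tail probability of the largest jump is asymptotically equivalent to that of a jump divided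
by `1 - ρ`, uniformly beyond a sufficiently high level. -/
theorem tendsto_iSup_abs_div_sub_one (H : IsMarkedPoisson B N r P)
    (hB2 : MemLp (B 0) 2 P) (hr : (r : ℝ) * ∫ ω, B 0 ω ∂P = 1)
    (hpos : ∀ x, 0 < P.real {ω | x < B 0 ω}) {xhat : ℝ≥0 → ℝ}
    (hxhat : Tendsto (fun ρ : ℝ≥0 => P.real {ω | xhat ρ < B 0 ω} / (1 - (ρ : ℝ)) ^ 2)
      (𝓝[<] (1 : ℝ≥0)) (𝓝 0)) :
    Tendsto (fun ρ : ℝ≥0 => ⨆ (x : ℝ) (_ : xhat ρ ≤ x), ENNReal.ofReal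
        |P.real {ω | (x : EReal) < largestJump B N ρ ω} /
          (1 / (1 - (ρ : ℝ)) * P.real {ω | x < B 0 ω}) - 1|)
      (𝓝[<] (1 : ℝ≥0)) (𝓝 0) := by
  have hcont : Continuous fun E : ℝ => ENNReal.ofReal
      (r * (((∫ ω, B 0 ω ^ 2 ∂P) + 1) / 2) * √E + (r : ℝ) ^ 2 / 2 * (∫ ω, B 0 ω ^ 2 ∂P) * E) :=
    ENNReal.continuous_ofReal.comp (by fun_prop)
  have hlim := (hcont.tendsto 0).comp hxhat
  simp only [Real.sqrt_zero, mul_zero, add_zero, ENNReal.ofReal_zero] at hlim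
  refine tendsto_of_tendsto_of_tendsto_of_le_of_le' tendsto_const_nhds hlim
    (Eventually.of_forall fun _ => zero_le) ?_
  have hρ0 : ∀ᶠ ρ : ℝ≥0 in 𝓝[<] 1, 0 < ρ :=
    eventually_nhdsWithin_of_eventually_nhds (lt_mem_nhds zero_lt_one)
  filter_upwards [hρ0, self_mem_nhdsWithin] with ρ h0 h1
  refine iSup₂_le fun x hx => ENNReal.ofReal_le_ofReal ?_
  refine H.abs_measureReal_largestJump_div_sub_one_le hB2 hr h0 h1 (hpos x) ?_
  -- Uniformity: the error at every `x ≥ xhat ρ` is controlled by the ratio at `xhat ρ`.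
  exact div_le_div_of_nonneg_right (measureReal_gt_antitone hx) (sq_nonneg _)

end ProbabilityTheory.IsMarkedPoisson

/-- At level `y = 1 / (1 - ρ)` the ratio is `y² P(X > y)`, and higher levels only decrease it. -/
theorem tendsto_tail_div_sq {Ω : Type*} [MeasurableSpace Ω] {P : Measure Ω} [IsProbabilityMeasure P]
    {X : Ω → ℝ} (hX : Measurable X) (hX2 : MemLp X 2 P) {xhat : ℝ≥0 → ℝ}
    (hxhat : ∀ᶠ ρ : ℝ≥0 in 𝓝[<] (1 : ℝ≥0), 1 / (1 - (ρ : ℝ)) ≤ xhat ρ) :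
    Tendsto (fun ρ : ℝ≥0 => P.real {ω | xhat ρ < X ω} / (1 - (ρ : ℝ)) ^ 2)
      (𝓝[<] (1 : ℝ≥0)) (𝓝 0) := by
  have hsub : Tendsto (fun ρ : ℝ≥0 => 1 - (ρ : ℝ)) (𝓝[<] (1 : ℝ≥0)) (𝓝[>] 0) := by
    refine tendsto_nhdsWithin_iff.2 ⟨?_, ?_⟩
    · have : Continuous fun ρ : ℝ≥0 => 1 - (ρ : ℝ) := by fun_prop
      have h := (this.tendsto 1).mono_left (nhdsWithin_le_nhds (s := Set.Iio 1))
      simpa using h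
    · filter_upwards [self_mem_nhdsWithin] with ρ hρ
      have : (ρ : ℝ) < 1 := by exact_mod_cast hρ
      exact sub_pos.2 this
  have hlim := (tendsto_sq_mul_tail hX hX2).comp (tendsto_inv_nhdsGT_zero.comp hsub)
  refine tendsto_of_tendsto_of_tendsto_of_le_of_le' tendsto_const_nhds hlim
    (Eventually.of_forall fun ρ => div_nonneg measureReal_nonneg (sq_nonneg _)) ?_
  filter_upwards [hxhat] with ρ hρ
  rw [one_div] at hρ
  have h := measureReal_gt_antitone (P := P) (X := X) hρ
  simp only [Function.comp_apply]
  rw [div_eq_inv_mul, ← inv_pow]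
  exact mul_le_mul_of_nonneg_left h (sq_nonneg _)

theorem theorem3 {Ω : Type*} [MeasurableSpace Ω] (P : Measure Ω) [IsProbabilityMeasure P]
    (B : ℕ → Ω → ℝ) (N : ℝ≥0 → Ω → ℕ)
    (hB_meas : ∀ i, Measurable (B i))
    (hB_indep : iIndepFun B P)
    (hB_ident : ∀ i, IdentDistrib (B i) (B 0) P P)
    (hB_pos : ∀ᵐ ω ∂P, 0 < B 0 ω)
    (α : ℝ) (hα : 2 < α) (hα3 : α ≠ 3)
    (L : ℝ → ℝ) (hL : SlowlyVarying L)
    (hB_tail : ∀ x : ℝ, 0 < x → P.real {ω | x < B 0 ω} = L x * x ^ (-α))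
    (hN : IsPoissonProcess N (Real.toNNReal (1 / ∫ ω, B 0 ω ∂P)) P)
    (hBN : IndepFun (fun ω (i : ℕ) => B i ω) (fun ω (t : ℝ≥0) => N t ω) P) :
    (∀ xhat : ℝ≥0 → ℝ,
      Tendsto (fun ρ : ℝ≥0 => P.real {ω | xhat ρ < B 0 ω} / (1 - (ρ : ℝ)) ^ 2)
        (𝓝[<] (1 : ℝ≥0)) (𝓝 0) →
      Tendsto (fun ρ : ℝ≥0 => ⨆ (x : ℝ) (_ : xhat ρ ≤ x), ENNReal.ofReal
          |P.real {ω | (x : EReal) < largestJump B N ρ ω} /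
            (1 / (1 - (ρ : ℝ)) * P.real {ω | x < B 0 ω}) - 1|)
        (𝓝[<] (1 : ℝ≥0)) (𝓝 0)) ∧
    (∀ xhat : ℝ≥0 → ℝ,
      (∀ᶠ ρ : ℝ≥0 in 𝓝[<] (1 : ℝ≥0), 1 / (1 - (ρ : ℝ)) ≤ xhat ρ) →
      Tendsto (fun ρ : ℝ≥0 => ⨆ (x : ℝ) (_ : xhat ρ ≤ x), ENNReal.ofReal
          |P.real {ω | (x : EReal) < largestJump B N ρ ω} /
            (1 / (1 - (ρ : ℝ)) * P.real {ω | x < B 0 ω}) - 1|)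
        (𝓝[<] (1 : ℝ≥0)) (𝓝 0)) := by
  have hpos := tail_pos hL hB_tail
  have hB2 := memLp_two_of_slowlyVarying (hB_meas 0) hB_pos hL hα hB_tail
  -- A positive mean excludes the default value of `1 / 0` in the rate.
  have hm : 0 < ∫ ω, B 0 ω ∂P := by
    rw [integral_pos_iff_support_of_nonneg_ae (hB_pos.mono fun ω hω => hω.le)
      (hB2.integrable one_le_two)]
    refine pos_iff_ne_zero.2 fun h => ?_
    have hne : ∀ᵐ ω ∂P, B 0 ω = 0 := h
    obtain ⟨ω, h1, h2⟩ := (hB_pos.and hne).exists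
    exact h1.ne' h2
  have hr : ((1 / ∫ ω, B 0 ω ∂P).toNNReal : ℝ) * ∫ ω, B 0 ω ∂P = 1 := by
    rw [Real.coe_toNNReal _ (by positivity), one_div_mul_cancel hm.ne']
  have H : IsMarkedPoisson B N (Real.toNNReal (1 / ∫ ω, B 0 ω ∂P)) P :=
    ⟨hB_meas, hB_indep, hB_ident, hB_pos, hN, hBN⟩
  exact ⟨fun xhat hx => H.tendsto_iSup_abs_div_sub_one hB2 hr hpos hx,
    fun xhat hx => H.tendsto_iSup_abs_div_sub_one hB2 hr hpos
      (tendsto_tail_div_sq (hB_meas 0) hB2 hx)⟩
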